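/- \textbf{Theorem (Dirichlet problem for mean curvature flow).} Let $\Omega\subset\mathbb R^n$ be a bounded domain (open and connected) with $C^2$ boundary that is mean-convex: at every point of $\partial\Omega$ the sum of the principal curvatures of $\partial\Omega$, with the sign for which they are positive for a ball, satisfies $\sum_{i=1}^{n-1}\kappa_i\ge 0$. Let $u:\overline\Omega\times[0,T)\to\mathbb R$ be continuous on $\overline\Omega\times[0,T)$, smooth on $\Omega\times(0,T)$, and a solution of mean curvature flow for graphs with zero boundary values, \[ \frac{\partial u}{\partial t}=\sum_{i,j=1}^n\left(\delta_{ij}-\frac{D_iu\,D_ju}{1+|Du|^2}\right)D_{ij}u\ \text{ in }\Omega\times(0,T),\qquad u=0\ \text{ on }\partial\Omega\times(0,T),\qquad u(\cdot,0)=u_0, \] and let $M=\sup_\Omega|u_0|$. Let $\varphi=\varphi(z,t)$ be a solution of curve shortening flow on the half-line with step data: $\varphi$ is smooth on $[0,\infty)\times(0,S)$, continuous on $(0,\infty)\times[0,S)$, and \[ \varphi_t=\frac{\varphi''}{1+(\varphi')^2}\ \text{ for } z>0,\ 0<t<S, \] \[ \varphi(z,0)=1\ \text{ for } z>0,\qquad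 \varphi(0,t)=0\ \text{ and }\ \lim_{z\to\infty}\varphi(z,t)=1\ \text{ for } 0<t<S, \] where $'$ denotes $\partial/\partial z$. Then for all $t\in(0,T)$ with $t/(4M^2)<S$ and all $x,y\in\overline\Omega$, \[ |u(y,t)-u(x,t)|\le 2M\,\varphi\left(\frac{|y-x|}{2M},\frac{t}{4M^2}\right), \] and consequently, for all $x\in\Omega$, the gradient bound \[ |Du(x,t)|\le\varphi'\left(0,\frac{t}{4M^2}\right) \] holds; its right-hand side does not depend on the gradient of $u_0$. (If $M=0$, the condition $t/(4M^2)<S$ is read as $0<S$ and both right-hand sides are read as $0$.) -/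

import Mathlib

open Set Filter Topology
open scoped ContDiff Gradient

/-- `ρ` is a `C²` defining function of `Ω` on the open neighbourhood `U` of the point `x`: it has
nowhere vanishing gradient on `U`, and inside `U` the set `Ω` is `{ρ < 0}`
(so that inside `U` the boundary of `Ω` is the regular level set `{ρ = 0}`). -/
structure IsLocalDefiningFunction {n : ℕ} (Ω : Set (EuclideanSpace ℝ (Fin n)))
    (x : EuclideanSpace ℝ (Fin n)) (U : Set (EuclideanSpace ℝ (Fin n)))
    (ρ : EuclideanSpace ℝ (Fin n) → ℝ) : Prop where
  isOpen : IsOpen U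
  mem : x ∈ U
  contDiffOn : ContDiffOn ℝ 2 ρ U
  gradient_ne_zero : ∀ y ∈ U, ∇ ρ y ≠ 0
  mem_iff : ∀ y ∈ U, (y ∈ Ω ↔ ρ y < 0)

/-- The boundary of `Ω` is of class `C²`, with `Ω` locally on one side of it. -/
def HasC2Boundary {n : ℕ} (Ω : Set (EuclideanSpace ℝ (Fin n))) : Prop :=
  ∀ x ∈ frontier Ω, ∃ U ρ, IsLocalDefiningFunction Ω x U ρ

/-- The tangent space at `x` of the level set of `ρ` through `x`. -/
noncomputable abbrev levelTangent {n : ℕ} (ρ : EuclideanSpace ℝ (Fin n) → ℝ) (x : EuclideanSpace ℝ (Fin n)) :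
    Submodule ℝ (EuclideanSpace ℝ (Fin n)) :=
  (Submodule.span ℝ {∇ ρ x})ᗮ

/-- The shape operator at `x` of the level set of `ρ` through `x`, that is, the derivative along the
tangent space of the unit normal field `∇ρ / |∇ρ|`: the tangential part of the Hessian of `ρ`,
divided by `|∇ρ|`. The normal points out of `{ρ < 0}`, so that the unit ball has the identity as
its shape operator. -/
noncomputable def shapeOperator {n : ℕ} (ρ : EuclideanSpace ℝ (Fin n) → ℝ)
    (x : EuclideanSpace ℝ (Fin n)) : levelTangent ρ x →ₗ[ℝ] levelTangent ρ x :=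
  ‖∇ ρ x‖⁻¹ • ((levelTangent ρ x).orthogonalProjectionOnto.toLinearMap ∘ₗ
    (fderiv ℝ (∇ ρ) x).toLinearMap ∘ₗ (levelTangent ρ x).subtype)

/-- The principal curvatures: the eigenvalues of the shape operator, with multiplicity. -/
noncomputable def principalCurvatures {n : ℕ} (ρ : EuclideanSpace ℝ (Fin n) → ℝ)
    (x : EuclideanSpace ℝ (Fin n)) : Multiset ℝ :=
  (shapeOperator ρ x).charpoly.roots

/-- `Ω` is mean-convex: at every boundary point the sum of the principal curvatures of `∂Ω` is
non-negative. (The principal curvatures do not depend on the defining function.) -/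
def IsMeanConvex {n : ℕ} (Ω : Set (EuclideanSpace ℝ (Fin n))) : Prop :=
  ∀ x ∈ frontier Ω, ∀ U ρ, IsLocalDefiningFunction Ω x U ρ → 0 ≤ (principalCurvatures ρ x).sum

/-- The partial derivative `D_i v (x)`. -/
noncomputable def partialD {n : ℕ} (i : Fin n) (v : EuclideanSpace ℝ (Fin n) → ℝ)
    (x : EuclideanSpace ℝ (Fin n)) : ℝ :=
  fderiv ℝ v x (EuclideanSpace.single i 1)

/-- The spatial operator of mean curvature flow for graphs,
`∑_{i,j} (δ_ij - D_i v D_j v / (1 + |Dv|²)) D_ij v`. -/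
noncomputable def graphMCFOperator {n : ℕ} (v : EuclideanSpace ℝ (Fin n) → ℝ)
    (x : EuclideanSpace ℝ (Fin n)) : ℝ :=
  ∑ i, ∑ j, ((if i = j then (1 : ℝ) else 0)
    - partialD i v x * partialD j v x / (1 + ∑ k, partialD k v x ^ 2))
    * partialD i (partialD j v) x

/-- `u` is a classical solution on `[0, T)` of mean curvature flow for graphs over `Ω`, smooth for
`0 < t < T`, continuous up to the boundary and up to the initial time, with zero boundary values and
initial values `u₀`. -/
structure IsGraphMCFDirichletSolution {n : ℕ} (Ω : Set (EuclideanSpace ℝ (Fin n))) (T : ℝ)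
    (u₀ : EuclideanSpace ℝ (Fin n) → ℝ) (u : EuclideanSpace ℝ (Fin n) → ℝ → ℝ) : Prop where
  continuousOn : ContinuousOn (fun p : EuclideanSpace ℝ (Fin n) × ℝ => u p.1 p.2)
    (closure Ω ×ˢ Ico 0 T)
  smooth : ContDiffOn ℝ ∞ (fun p : EuclideanSpace ℝ (Fin n) × ℝ => u p.1 p.2) (Ω ×ˢ Ioo 0 T)
  equation : ∀ x ∈ Ω, ∀ t ∈ Ioo 0 T,
    deriv (fun s => u x s) t = graphMCFOperator (fun y => u y t) x
  boundary : ∀ x ∈ frontier Ω, ∀ t ∈ Ioo 0 T, u x t = 0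
  initial : ∀ x ∈ Ω, u x 0 = u₀ x

/-- `φ` is a solution of curve shortening flow `φ_t = φ'' / (1 + (φ')²)` on the half-line `z ≥ 0`
for `0 < t < S`, smooth up to `z = 0`, with boundary value `0` at `z = 0`, limit `1` as `z → ∞`, and
initial value `1` for `z > 0`, attained continuously. Nothing is asked at the corner
`(z, t) = (0, 0)`, where the initial and the boundary value disagree. -/
structure IsStepCSFSolution (S : ℝ) (φ : ℝ → ℝ → ℝ) : Prop where
  smooth : ContDiffOn ℝ ∞ (fun p : ℝ × ℝ => φ p.1 p.2) (Ici 0 ×ˢ Ioo 0 S)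
  equation : ∀ z > 0, ∀ t ∈ Ioo 0 S,
    deriv (fun s => φ z s) t
      = iteratedDeriv 2 (fun y => φ y t) z / (1 + deriv (fun y => φ y t) z ^ 2)
  initial_continuousOn : ContinuousOn (fun p : ℝ × ℝ => φ p.1 p.2) (Ioi 0 ×ˢ Ico 0 S)
  initial : ∀ z > 0, φ z 0 = 1
  boundary : ∀ t ∈ Ioo 0 S, φ 0 t = 0
  tendsto_atTop : ∀ t ∈ Ioo 0 S, Tendsto (fun z => φ z t) atTop (𝓝 1)

/-! The proof doubles the variables. Put Φ(z,t) = 2Mφ(z/2M, t/4M²), again a solution of curve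
shortening flow. If u(y,t) - u(x,t) - Φ(|y-x|,t) is positive somewhere, then after subtracting a
small multiple of t it has a positive maximum over pairs of points and times, off the diagonal and
after the small starting time. Let e be the unit vector from x to y and p, q the first two
derivatives of Φ in z there.

If both points are interior, both gradients of u equal p e. Translating the pair together compares
the two Hessians in every direction, and moving one point along e bounds the second derivatives
along e by q. So the two values of the operator differ by at most q/(1+p²) = Φ_t, against the sign
of the time derivative at the maximum (`graphMCFOperator_sub_le_of_interior_max`).

If x lies on the boundary, u vanishes there and only y contributes. For p > 0 the ball about y
through x lies in Ω, so e is the inner normal at x. Sliding x along the boundary while y moves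
orthogonally to e bounds the Hessian of u on the complement of e by -p times the second fundamental
form; mean-convexity makes its trace nonpositive (`graphMCFOperator_le_of_boundary_max`). For p = 0
a radial comparison suffices.

The argument needs φ nonnegative, nondecreasing in z, and close to 1 off the diagonal at small
times. Nothing, not even boundedness, is assumed at the corner (0,0), so ordinary comparison does
not apply directly. Grim reapers, infinite at both ends of an interval, give 1 - φ ≤ πt/(2z) and a
logarithmic bound near the corner. The integral of the cubed excess over a level above the boundary
values is nonincreasing in time, and the logarithmic bound forces it to 0 as t → 0 (`le_boundary`).
Hence 0 ≤ φ ≤ 1, and comparison of φ with its translates gives monotonicity. The gradient bound is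
the slope of the modulus at 0. -/

/-- `k` is differentiable near `s` with `k' s = a`, and `k'` has derivative `b` at `s`. -/
def HasSecondDerivAt (k : ℝ → ℝ) (a b s : ℝ) : Prop :=
  ∃ k' : ℝ → ℝ, k' s = a ∧ (∀ᶠ r in 𝓝 s, HasDerivAt k (k' r) r) ∧ HasDerivAt k' b s

/-! ### Second-order calculus at touching points. -/

namespace HasSecondDerivAt

variable {k l : ℝ → ℝ} {a b c d s : ℝ}

theorem hasDerivAt (h : HasSecondDerivAt k a b s) : HasDerivAt k a s := by
  obtain ⟨k', rfl, h1, -⟩ := h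
  exact h1.self_of_nhds

theorem deriv_eq (h : HasSecondDerivAt k a b s) : deriv k s = a := h.hasDerivAt.deriv

theorem deriv_deriv_eq (h : HasSecondDerivAt k a b s) : deriv (deriv k) s = b := by
  obtain ⟨k', -, h1, h2⟩ := h
  have : deriv k =ᶠ[𝓝 s] k' := h1.mono fun r hr => hr.deriv
  rw [this.deriv_eq, h2.deriv]

theorem sub (h : HasSecondDerivAt k a b s) (h' : HasSecondDerivAt l c d s) :
    HasSecondDerivAt (fun r => k r - l r) (a - c) (b - d) s := by
  obtain ⟨k', rfl, h1, h2⟩ := h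
  obtain ⟨l', rfl, h1', h2'⟩ := h'
  refine ⟨fun r => k' r - l' r, rfl, ?_, h2.sub h2'⟩
  filter_upwards [h1, h1'] with r hr hr' using hr.sub hr'

theorem const_mul (h : HasSecondDerivAt k a b s) (c : ℝ) :
    HasSecondDerivAt (fun r => c * k r) (c * a) (c * b) s := by
  obtain ⟨k', rfl, h1, h2⟩ := h
  refine ⟨fun r => c * k' r, rfl, ?_, h2.const_mul c⟩
  filter_upwards [h1] with r hr using hr.const_mul c

theorem const (c s : ℝ) : HasSecondDerivAt (fun _ => c) 0 0 s :=
  ⟨fun _ => 0, rfl, Eventually.of_forall fun r => hasDerivAt_const r c, hasDerivAt_const s 0⟩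

theorem neg (h : HasSecondDerivAt k a b s) : HasSecondDerivAt (fun r => -k r) (-a) (-b) s := by
  simpa using h.const_mul (-1)

theorem of_contDiffAt (h : ContDiffAt ℝ 2 k s) :
    HasSecondDerivAt k (deriv k s) (deriv (deriv k) s) s := by
  refine ⟨deriv k, rfl, ?_, ?_⟩
  · have := h.eventually (by simp)
    filter_upwards [this] with r hr using (hr.differentiableAt (by simp)).hasDerivAt
  · have h2 : ContDiffAt ℝ 1 (deriv k) s := by
      have := h.fderiv_right (m := 1) (by norm_num)
      exact this.clm_apply contDiffAt_const
    exact (h2.differentiableAt (by simp)).hasDerivAt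

/-- Composition with a function with first derivative `u`, second derivative `v`. -/
theorem comp {g : ℝ → ℝ} {u v : ℝ} (h : HasSecondDerivAt k a b (g s))
    (hg : HasSecondDerivAt g u v s) :
    HasSecondDerivAt (fun r => k (g r)) (a * u) (b * u * u + a * v) s := by
  have hgc := hg.hasDerivAt.continuousAt
  have hgd := hg.hasDerivAt
  obtain ⟨k', rfl, h1, h2⟩ := h
  obtain ⟨g', rfl, h3, h4⟩ := hg
  refine ⟨fun r => k' (g r) * g' r, rfl, ?_, (h2.comp s hgd).mul h4⟩
  filter_upwards [h3, hgc.eventually h1] with r hr hr' using hr'.comp r hr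

/-- Meant as inner function for `comp`: its velocity vanishes at 0, so k(r + m s²) has second
derivative 2m k'(r) there, free of k''. -/
theorem quadratic (r m : ℝ) : HasSecondDerivAt (fun s => r + m * s ^ 2) 0 (2 * m) 0 := by
  refine ⟨fun s => m * (2 * s), by simp, Eventually.of_forall fun s => ?_, ?_⟩
  · simpa using ((hasDerivAt_pow 2 s).const_mul m).const_add r
  · simpa [mul_comm] using ((hasDerivAt_id (0 : ℝ)).const_mul 2).const_mul m

theorem affine (r c s : ℝ) : HasSecondDerivAt (fun s => r + c * s) c 0 s := by
  refine ⟨fun _ => c, rfl, Eventually.of_forall fun s => ?_, hasDerivAt_const _ _⟩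
  simpa using ((hasDerivAt_id s).const_mul c).const_add r

theorem isLocalMin (h : HasSecondDerivAt k 0 b s) (hb : 0 < b) : IsLocalMin k s :=
  isLocalMin_of_deriv_deriv_pos (by rwa [h.deriv_deriv_eq]) h.deriv_eq h.hasDerivAt.continuousAt

theorem first_eq_zero (h : HasSecondDerivAt k a b s) (hm : IsLocalMax k s) : a = 0 :=
  hm.hasDerivAt_eq_zero h.hasDerivAt

/-- If b were positive, s would be a local minimum as well, so k would be locally constant and b
would vanish. -/
theorem second_nonpos (h : HasSecondDerivAt k a b s) (hm : IsLocalMax k s) : b ≤ 0 := by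
  by_contra! hb
  obtain rfl := h.first_eq_zero hm
  have hmin := h.isLocalMin hb
  have heq : k =ᶠ[𝓝 s] fun _ => k s := by
    filter_upwards [hm, hmin] with r h1 h2 using le_antisymm h1 h2
  have h0 : deriv (deriv k) s = 0 := by
    rw [heq.deriv.deriv_eq]; simp
  rw [h.deriv_deriv_eq] at h0
  exact hb.ne' h0

/-- Second order comparison at a point where `k - l` has a local maximum. -/
theorem touching (h : HasSecondDerivAt k a b s) (h' : HasSecondDerivAt l c d s)
    (hm : IsLocalMax (fun r => k r - l r) s) : a = c ∧ b ≤ d :=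
  ⟨sub_eq_zero.1 ((h.sub h').first_eq_zero hm), sub_nonpos.1 ((h.sub h').second_nonpos hm)⟩

end HasSecondDerivAt

/-- A function which is largest at the right end of an interval has nonnegative derivative there. -/
theorem HasDerivAt.nonneg_of_forall_le_left {f : ℝ → ℝ} {f' a b : ℝ} (hf : HasDerivAt f f' b)
    (hab : a < b) (hle : ∀ s ∈ Icc a b, f s ≤ f b) : 0 ≤ f' := by
  have h1 : HasDerivWithinAt f f' (Iio b) b := hf.hasDerivWithinAt
  rw [hasDerivWithinAt_iff_tendsto_slope' (by simp)] at h1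
  refine ge_of_tendsto h1 ?_
  filter_upwards [Ico_mem_nhdsLT hab] with s hs
  rw [slope_def_field]
  exact div_nonneg_of_nonpos (sub_nonpos.2 (hle s ⟨hs.1, hs.2.le⟩)) (sub_nonpos.2 hs.2.le)

section Path

variable {F : Type*} [NormedAddCommGroup F] [NormedSpace ℝ F]

/-- The second order expansion of `v` along the parabola `x + s w + s² c`. -/
theorem ContDiffAt.hasSecondDerivAt_parabola {v : F → ℝ} {x : F} (hv : ContDiffAt ℝ 2 v x)
    (w c : F) :
    HasSecondDerivAt (fun s : ℝ => v (x + s • w + s ^ 2 • c)) (fderiv ℝ v x w)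
      (fderiv ℝ (fderiv ℝ v) x w w + 2 * fderiv ℝ v x c) 0 := by
  set γ : ℝ → F := fun s => x + s • w + s ^ 2 • c with hγ
  have hγ0 : γ 0 = x := by simp [hγ]
  have hγd : ∀ s : ℝ, HasDerivAt γ (w + (2 * s) • c) s := by
    intro s
    have h1 : HasDerivAt (fun s : ℝ => s • w) w s := by
      simpa using (hasDerivAt_id s).smul_const w
    have h2 : HasDerivAt (fun s : ℝ => s ^ 2 • c) ((2 * s) • c) s := by
      simpa using (hasDerivAt_pow 2 s).smul_const c
    exact (h1.const_add x).add h2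
  refine ⟨fun s => fderiv ℝ v (γ s) (w + (2 * s) • c), by simp [hγ0], ?_, ?_⟩
  · have hev : ∀ᶠ y in 𝓝 (γ 0), DifferentiableAt ℝ v y := by
      rw [hγ0]
      filter_upwards [hv.eventually (by simp)] with y hy using hy.differentiableAt (by simp)
    filter_upwards [(hγd 0).continuousAt.eventually hev] with s hs
    exact hs.hasFDerivAt.comp_hasDerivAt s (hγd s)
  · have h2 : HasFDerivAt (fderiv ℝ v) (fderiv ℝ (fderiv ℝ v) x) (γ 0) := by
      rw [hγ0]
      have := hv.fderiv_right (m := 1) (by norm_num)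
      exact (this.differentiableAt (by simp)).hasFDerivAt
    have h3 := h2.comp_hasDerivAt (0 : ℝ) (hγd 0)
    have h4 : HasDerivAt (fun s : ℝ => w + (2 * s) • c) ((2 : ℝ) • c) 0 := by
      have := ((hasDerivAt_id (0 : ℝ)).const_mul 2).smul_const c
      simpa using this.const_add w
    have h5 := h3.clm_apply h4
    simpa [hγ0] using h5

theorem ContDiffAt.hasSecondDerivAt_line {v : F → ℝ} {x : F} (hv : ContDiffAt ℝ 2 v x) (w : F) :
    HasSecondDerivAt (fun s : ℝ => v (x + s • w)) (fderiv ℝ v x w)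
      (fderiv ℝ (fderiv ℝ v) x w w) 0 := by
  simpa using hv.hasSecondDerivAt_parabola w 0

end Path

/-! ### Curve shortening flow: symmetries, comparison, grim reapers. -/

/-- `f` solves the graphical curve shortening flow equation `f_t = f'' / (1 + (f')²)` at `(z, t)`. -/
def IsCSFAt (f : ℝ → ℝ → ℝ) (z t : ℝ) : Prop :=
  ∃ ft p q : ℝ, HasDerivAt (fun s => f z s) ft t ∧ HasSecondDerivAt (fun y => f y t) p q z ∧
    ft = q / (1 + p ^ 2)

theorem IsCSFAt.neg {f : ℝ → ℝ → ℝ} {z t : ℝ} (h : IsCSFAt f z t) :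
    IsCSFAt (fun z t => -f z t) z t := by
  obtain ⟨ft, p, q, h1, h2, h3⟩ := h
  exact ⟨-ft, -p, -q, h1.neg, h2.neg, by rw [h3]; ring⟩

theorem IsCSFAt.sub_const {f : ℝ → ℝ → ℝ} {z t : ℝ} (h : IsCSFAt f z t) (c : ℝ) :
    IsCSFAt (fun z t => f z t - c) z t := by
  obtain ⟨ft, p, q, h1, h2, h3⟩ := h
  exact ⟨ft, p, q, h1.sub_const c, by simpa using h2.sub (HasSecondDerivAt.const c z), h3⟩

theorem IsCSFAt.comp_add_left {f : ℝ → ℝ → ℝ} {z t d : ℝ} (h : IsCSFAt f (d + z) t) :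
    IsCSFAt (fun z t => f (d + z) t) z t := by
  obtain ⟨ft, p, q, h1, h2, h3⟩ := h
  refine ⟨ft, p, q, h1, ?_, h3⟩
  have h4 := HasSecondDerivAt.affine d 1 z
  simp only [one_mul] at h4
  simpa using h2.comp (g := fun s => d + s) h4

/-- Parabolic rescaling. -/
theorem IsCSFAt.rescale {f : ℝ → ℝ → ℝ} {z t c : ℝ} (hc : c ≠ 0)
    (h : IsCSFAt f (z / c) (t / c ^ 2)) :
    IsCSFAt (fun z t => c * f (z / c) (t / c ^ 2)) z t := by
  obtain ⟨ft, p, q, h1, h2, h3⟩ := h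
  refine ⟨c * (ft * (1 / c ^ 2)), c * (p * c⁻¹), c * (q * c⁻¹ * c⁻¹ + p * 0), ?_, ?_, ?_⟩
  · have h4 : HasDerivAt (fun s : ℝ => s / c ^ 2) (1 / c ^ 2) t := (hasDerivAt_id t).div_const _
    exact (h1.comp t h4).const_mul c
  · have h4 : HasSecondDerivAt (fun s => s / c) c⁻¹ 0 z := by
      have := HasSecondDerivAt.affine 0 c⁻¹ z
      simpa [div_eq_inv_mul] using this
    exact (h2.comp (g := fun s => s / c) h4).const_mul c
  · have : 1 + p ^ 2 ≠ 0 := by positivity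
    rw [h3]
    have e : c * (p * c⁻¹) = p := by field_simp
    rw [e]
    field_simp
    ring

/-- The comparison principle for curve shortening flow of graphs on a rectangle. -/
theorem csf_comparison {f g : ℝ → ℝ → ℝ} {a b t₀ t₁ c : ℝ}
    (hf : ContinuousOn (fun p : ℝ × ℝ => f p.1 p.2) (Icc a b ×ˢ Icc t₀ t₁))
    (hg : ContinuousOn (fun p : ℝ × ℝ => g p.1 p.2) (Icc a b ×ˢ Icc t₀ t₁))
    (hf' : ∀ z ∈ Ioo a b, ∀ t ∈ Ioc t₀ t₁, IsCSFAt f z t)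
    (hg' : ∀ z ∈ Ioo a b, ∀ t ∈ Ioc t₀ t₁, IsCSFAt g z t)
    (hinit : ∀ z ∈ Icc a b, f z t₀ ≤ g z t₀ + c)
    (hleft : ∀ t ∈ Icc t₀ t₁, f a t ≤ g a t + c)
    (hright : ∀ t ∈ Icc t₀ t₁, f b t ≤ g b t + c) :
    ∀ z ∈ Icc a b, ∀ t ∈ Icc t₀ t₁, f z t ≤ g z t + c := by
  intro z hz t ht
  by_contra! hlt
  set η := f z t - g z t - c with hη
  have hηpos : 0 < η := by linarith
  -- The penalty ε(t - t₀) makes the time inequality at the maximum strict without absorbing the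
  -- violation η; the + 1 covers t₀ = t₁.
  set ε := η / (2 * (t₁ - t₀ + 1)) with hε
  have hden : 0 < t₁ - t₀ + 1 := by linarith [ht.1.trans ht.2]
  have hεpos : 0 < ε := by positivity
  have hεη : ε * (t₁ - t₀) < η := by
    rw [hε, div_mul_eq_mul_div, div_lt_iff₀ (by positivity)]
    nlinarith
  let D : ℝ × ℝ → ℝ := fun p => f p.1 p.2 - g p.1 p.2 - ε * (p.2 - t₀)
  have hDc : ContinuousOn D (Icc a b ×ˢ Icc t₀ t₁) := by
    refine (hf.sub hg).sub ?_
    fun_prop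
  obtain ⟨⟨z₀, s₀⟩, ⟨hz₀, hs₀⟩, hmax⟩ :=
    (isCompact_Icc.prod isCompact_Icc).exists_isMaxOn ⟨(z, t), hz, ht⟩ hDc
  simp only at hz₀ hs₀
  have hmax' : ∀ y ∈ Icc a b, ∀ s ∈ Icc t₀ t₁, D (y, s) ≤ D (z₀, s₀) :=
    fun y hy s hs => hmax (show (y, s) ∈ _ from ⟨hy, hs⟩)
  have hval : c < D (z₀, s₀) := by
    have := hmax' z hz t ht
    have h2 : ε * (t - t₀) ≤ ε * (t₁ - t₀) := by
      apply mul_le_mul_of_nonneg_left _ hεpos.le; linarith [ht.2]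
    simp only [D] at this ⊢
    linarith
  have hDval : D (z₀, s₀) ≤ f z₀ s₀ - g z₀ s₀ := by
    have : 0 ≤ ε * (s₀ - t₀) := mul_nonneg hεpos.le (by linarith [hs₀.1])
    simp only [D]; linarith
  have hs₀' : t₀ < s₀ := by
    rcases hs₀.1.eq_or_lt with h | h
    · subst h; linarith [hinit z₀ hz₀]
    · exact h
  have hza : a < z₀ := by
    rcases hz₀.1.eq_or_lt with h | h
    · subst h; linarith [hleft s₀ hs₀]
    · exact h
  have hzb : z₀ < b := by
    rcases hz₀.2.eq_or_lt with h | h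
    · subst h; linarith [hright s₀ hs₀]
    · exact h
  obtain ⟨ft, p, q, h1, h2, h3⟩ := hf' z₀ ⟨hza, hzb⟩ s₀ ⟨hs₀', hs₀.2⟩
  obtain ⟨gt, p', q', h1', h2', h3'⟩ := hg' z₀ ⟨hza, hzb⟩ s₀ ⟨hs₀', hs₀.2⟩
  obtain ⟨rfl, hq⟩ := h2.touching h2' (by
    filter_upwards [Icc_mem_nhds hza hzb] with y hy
    have := hmax' y hy s₀ hs₀
    simp only [D] at this
    linarith)
  have htime : HasDerivAt (fun s => D (z₀, s)) (ft - gt - ε) s₀ := by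
    have h5 : HasDerivAt (fun s => ε * (s - t₀)) ε s₀ := by
      simpa using ((hasDerivAt_id s₀).sub_const t₀).const_mul ε
    exact (h1.sub h1').sub h5
  have := htime.nonneg_of_forall_le_left hs₀' fun s hs =>
    hmax' z₀ hz₀ s ⟨hs.1, hs.2.trans hs₀.2⟩
  have hle : ft ≤ gt := by
    rw [h3, h3']
    exact div_le_div_of_nonneg_right hq (by positivity)
  linarith

/-- The grim reaper `-c⁻¹ log (sin (c (z - a))) + c t` is a translating solution. -/
theorem isCSFAt_grimReaper {a c z : ℝ} (hc : 0 < c) (hz : a < z) (hz' : c * (z - a) < Real.pi)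
    (t : ℝ) : IsCSFAt (fun z t => -(c⁻¹ * Real.log (Real.sin (c * (z - a)))) + c * t) z t := by
  have hsin : ∀ y, a < y → c * (y - a) < Real.pi → 0 < Real.sin (c * (y - a)) := fun y h1 h2 =>
    Real.sin_pos_of_pos_of_lt_pi (mul_pos hc (by linarith)) h2
  have hlin : ∀ y : ℝ, HasDerivAt (fun y => c * (y - a)) c y := fun y => by
    simpa using ((hasDerivAt_id y).sub_const a).const_mul c
  set θ := c * (z - a) with hθ
  refine ⟨c, -(Real.cos θ / Real.sin θ),
    -(((-Real.sin θ * c) * Real.sin θ - Real.cos θ * (Real.cos θ * c)) / Real.sin θ ^ 2),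
    ?_, ⟨fun y => -(Real.cos (c * (y - a)) / Real.sin (c * (y - a))), rfl, ?_, ?_⟩, ?_⟩
  · simpa using ((hasDerivAt_id t).const_mul c).const_add (-(c⁻¹ * Real.log (Real.sin θ)))
  · have hopen : ∀ᶠ y in 𝓝 z, c * (y - a) < Real.pi :=
      (hlin z).continuousAt.eventually_lt_const hz'
    filter_upwards [eventually_gt_nhds hz, hopen] with y hy hy'
    have h1 := ((hlin y).sin.log (hsin y hy hy').ne').const_mul c⁻¹
    have h2 := h1.neg.add_const (c * t)
    have := (hsin y hy hy').ne'
    exact h2.congr_deriv (by field_simp)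
  · exact ((hlin z).cos.div (hlin z).sin (hsin z hz hz').ne').neg
  · have hs := (hsin z hz hz').ne'
    have hcs := Real.sin_sq_add_cos_sq θ
    rw [← hθ] at hs
    have h1 : 1 + (-(Real.cos θ / Real.sin θ)) ^ 2 = 1 / Real.sin θ ^ 2 := by
      field_simp; linarith
    rw [h1]
    field_simp
    linear_combination (-1 : ℝ) * hcs

/-! ### Half-line solutions: grim reaper bounds. -/

/-- A solution of curve shortening flow on the half-line with vanishing initial values and boundary
values at most `m`; no condition is imposed at the corner or at infinity. -/
structure IsHalfLineCSF (S m : ℝ) (f : ℝ → ℝ → ℝ) : Prop where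
  smooth : ContDiffOn ℝ 2 (fun p : ℝ × ℝ => f p.1 p.2) (Ioi 0 ×ˢ Ioo 0 S)
  isCSFAt : ∀ z > 0, ∀ t ∈ Ioo 0 S, IsCSFAt f z t
  continuousOn : ContinuousOn (fun p : ℝ × ℝ => f p.1 p.2) (Ici 0 ×ˢ Ioo 0 S)
  continuousOn_initial : ContinuousOn (fun p : ℝ × ℝ => f p.1 p.2) (Ioi 0 ×ˢ Ico 0 S)
  initial : ∀ z > 0, f z 0 = 0
  boundary : ∀ t ∈ Ioo 0 S, f 0 t ≤ m

namespace IsHalfLineCSF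

variable {S m : ℝ} {f : ℝ → ℝ → ℝ}

/-- The reaper is infinite at both ends of (a, a + π/c), while f is bounded on that compact strip
because a > 0 keeps it away from the corner. So the lateral comparison is free, and the boundary
values of f never enter. -/
theorem le_grimReaper_shift (h : IsHalfLineCSF S m f) {a c z t : ℝ} (ha : 0 < a) (hc : 0 < c)
    (hz : a < z) (hz' : c * (z - a) < Real.pi) (ht : t ∈ Ioo 0 S) :
    f z t ≤ -(c⁻¹ * Real.log (Real.sin (c * (z - a)))) + c * t := by
  have hcomp : IsCompact (Icc a (a + Real.pi / c) ×ˢ Icc 0 t) := isCompact_Icc.prod isCompact_Icc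
  have hfc : ContinuousOn (fun p : ℝ × ℝ => f p.1 p.2) (Icc a (a + Real.pi / c) ×ˢ Icc 0 t) :=
    h.continuousOn_initial.mono
      (prod_mono (fun y hy => ha.trans_le hy.1) fun s hs => ⟨hs.1, hs.2.trans_lt ht.2⟩)
  obtain ⟨K, hK⟩ := hcomp.bddAbove_image hfc
  have hK' : ∀ y ∈ Icc a (a + Real.pi / c), ∀ s ∈ Icc 0 t, f y s ≤ K := fun y hy s hs =>
    hK ⟨(y, s), ⟨hy, hs⟩, rfl⟩
  have hlim : Tendsto (fun θ => -(c⁻¹ * Real.log (Real.sin θ))) (𝓝[>] 0) atTop := by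
    have h1 : Tendsto Real.sin (𝓝[>] 0) (𝓝[≠] 0) := by
      refine tendsto_nhdsWithin_iff.2 ⟨?_, ?_⟩
      · have := Real.continuous_sin.tendsto 0
        rw [Real.sin_zero] at this
        exact this.mono_left nhdsWithin_le_nhds
      · filter_upwards [Ioo_mem_nhdsGT Real.pi_pos] with θ hθ
        exact (Real.sin_pos_of_pos_of_lt_pi hθ.1 hθ.2).ne'
    have h2 := Real.tendsto_log_nhdsNE_zero.comp h1
    exact tendsto_neg_atBot_atTop.comp (h2.const_mul_atBot (inv_pos.2 hc))
  set θ₀ := c * (z - a) with hθ₀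
  have hθ₀pos : 0 < θ₀ := mul_pos hc (by linarith)
  -- θ is the angle trimmed off at each end: so small that the reaper is at least K there and z
  -- remains inside.
  obtain ⟨θ, hθK, hθ⟩ := ((hlim.eventually_ge_atTop K).and
    (Ioo_mem_nhdsGT (lt_min (lt_min hθ₀pos (sub_pos.2 hz')) (half_pos Real.pi_pos)))).exists
  have hθ1 : θ < θ₀ := hθ.2.trans_le ((min_le_left _ _).trans (min_le_left _ _))
  have hθ2 : θ < Real.pi - θ₀ := hθ.2.trans_le ((min_le_left _ _).trans (min_le_right _ _))
  have hθpi : θ < Real.pi := by linarith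
  have hlow : ∀ y, a + θ / c ≤ y → a < y := fun y hy => by
    have : 0 < θ / c := div_pos hθ.1 hc
    linarith
  have hupp : ∀ y, y ≤ a + (Real.pi - θ) / c → c * (y - a) < Real.pi := fun y hy => by
    have h1 : y - a ≤ (Real.pi - θ) / c := by linarith
    rw [le_div_iff₀ hc] at h1
    have := hθ.1
    linarith
  have hsub : ∀ y ∈ Icc (a + θ / c) (a + (Real.pi - θ) / c), y ∈ Icc a (a + Real.pi / c) := by
    intro y hy
    refine ⟨(hlow y hy.1).le, hy.2.trans ?_⟩
    have := hθ.1
    gcongr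
    linarith
  have key := csf_comparison (f := f)
    (g := fun z t => -(c⁻¹ * Real.log (Real.sin (c * (z - a)))) + c * t)
    (a := a + θ / c) (b := a + (Real.pi - θ) / c) (t₀ := 0) (t₁ := t) (c := 0)
    (hfc.mono (prod_mono hsub subset_rfl)) ?_ ?_ ?_ ?_ ?_ ?_ z ?_ t ⟨ht.1.le, le_rfl⟩
  · simpa using key
  · have : ContinuousOn (fun p : ℝ × ℝ => Real.log (Real.sin (c * (p.1 - a))))
        (Icc (a + θ / c) (a + (Real.pi - θ) / c) ×ˢ Icc 0 t) := by
      refine ContinuousOn.log (by fun_prop) ?_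
      rintro ⟨y, s⟩ ⟨hy, -⟩
      exact (Real.sin_pos_of_pos_of_lt_pi (mul_pos hc (sub_pos.2 (hlow y hy.1)))
        (hupp y hy.2)).ne'
    fun_prop
  · intro y hy s hs
    exact h.isCSFAt y (ha.trans (hlow y hy.1.le)) s ⟨hs.1, hs.2.trans_lt ht.2⟩
  · intro y hy s hs
    exact isCSFAt_grimReaper hc (hlow y hy.1.le) (hupp y hy.2.le) s
  · intro y hy
    rw [h.initial y (ha.trans (hlow y hy.1))]
    have h1 : Real.log (Real.sin (c * (y - a))) ≤ 0 :=
      Real.log_nonpos (Real.sin_pos_of_pos_of_lt_pi (mul_pos hc (sub_pos.2 (hlow y hy.1)))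
        (hupp y hy.2)).le (Real.sin_le_one _)
    have h2 : c⁻¹ * Real.log (Real.sin (c * (y - a))) ≤ 0 :=
      mul_nonpos_of_nonneg_of_nonpos (inv_pos.2 hc).le h1
    linarith
  · intro s hs
    have e : c * (a + θ / c - a) = θ := by field_simp; ring
    have h1 := hK' (a + θ / c) (hsub _ ⟨le_rfl, by gcongr; linarith [(lt_min_iff.1 hθ.2).2]⟩) s hs
    have h2 : 0 ≤ c * s := mul_nonneg hc.le hs.1
    simp only [e]
    linarith
  · intro s hs
    have e : c * (a + (Real.pi - θ) / c - a) = Real.pi - θ := by field_simp; ring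
    have h1 := hK' (a + (Real.pi - θ) / c)
      (hsub _ ⟨by gcongr; linarith [(lt_min_iff.1 hθ.2).2], le_rfl⟩) s hs
    have h2 : 0 ≤ c * s := mul_nonneg hc.le hs.1
    simp only [e, Real.sin_pi_sub]
    linarith
  · constructor
    · have : θ / c ≤ z - a := by rw [div_le_iff₀ hc]; linarith
      linarith
    · have : z - a ≤ (Real.pi - θ) / c := by rw [le_div_iff₀ hc]; linarith
      linarith

theorem le_grimReaper (h : IsHalfLineCSF S m f) {c z t : ℝ} (hc : 0 < c)
    (hz : 0 < z) (hz' : c * z < Real.pi) (ht : t ∈ Ioo 0 S) :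
    f z t ≤ -(c⁻¹ * Real.log (Real.sin (c * z))) + c * t := by
  have hlim : Tendsto (fun a => -(c⁻¹ * Real.log (Real.sin (c * (z - a)))) + c * t) (𝓝[>] 0)
      (𝓝 (-(c⁻¹ * Real.log (Real.sin (c * z))) + c * t)) := by
    have : ContinuousAt (fun a => -(c⁻¹ * Real.log (Real.sin (c * (z - a)))) + c * t) 0 := by
      have : ContinuousAt (fun a => Real.log (Real.sin (c * (z - a)))) 0 := by
        refine ContinuousAt.log (by fun_prop) ?_
        simpa using (Real.sin_pos_of_pos_of_lt_pi (mul_pos hc hz) hz').ne'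
      fun_prop
    have h2 := this.tendsto.mono_left (nhdsWithin_le_nhds (s := Ioi 0))
    simpa using h2
  refine ge_of_tendsto hlim ?_
  filter_upwards [Ioo_mem_nhdsGT hz] with a ha
  exact h.le_grimReaper_shift ha.1 hc ha.2 (by nlinarith [ha.1]) ht

/-- This is the reaper whose interval (0, 2z) has z as midpoint, where the logarithm vanishes. -/
theorem le_div (h : IsHalfLineCSF S m f) {z t : ℝ} (hz : 0 < z) (ht : t ∈ Ioo 0 S) :
    f z t ≤ Real.pi * t / (2 * z) := by
  have hpi := Real.pi_pos
  have e : Real.pi / (2 * z) * z = Real.pi / 2 := by field_simp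
  have := h.le_grimReaper (c := Real.pi / (2 * z)) (by positivity) hz (by rw [e]; linarith) ht
  rw [e, Real.sin_pi_div_two, Real.log_one] at this
  calc f z t ≤ _ := this
    _ = _ := by ring

end IsHalfLineCSF

/-! ### Excess area and the maximum principle across the corner. -/

theorem hasDerivAt_max_zero_pow (k : ℕ) (s : ℝ) :
    HasDerivAt (fun s : ℝ => max s 0 ^ (k + 2)) ((k + 2) * max s 0 ^ (k + 1)) s := by
  rcases lt_trichotomy s 0 with hs | rfl | hs
  · have : (fun s : ℝ => max s 0 ^ (k + 2)) =ᶠ[𝓝 s] fun _ => 0 := by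
      filter_upwards [eventually_lt_nhds hs] with r hr
      simp [max_eq_right hr.le]
    simpa [max_eq_right hs.le] using (hasDerivAt_const s (0 : ℝ)).congr_of_eventuallyEq this
  · rw [hasDerivAt_iff_isLittleO_nhds_zero]
    simp only [zero_add, max_self, ne_eq, Nat.add_eq_zero_iff, OfNat.ofNat_ne_zero, and_false,
      not_false_eq_true, zero_pow, sub_zero, one_ne_zero, mul_zero, smul_zero]
    have h1 : (fun h : ℝ => max h 0 ^ (k + 2)) =O[𝓝 0] fun h : ℝ => h ^ (k + 2) := by
      refine Asymptotics.IsBigO.of_bound 1 (Eventually.of_forall fun h => ?_)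
      rw [one_mul, norm_pow, norm_pow]
      gcongr
      rw [Real.norm_eq_abs, Real.norm_eq_abs, abs_of_nonneg (le_max_right _ _)]
      exact max_le (le_abs_self h) (abs_nonneg h)
    refine h1.trans_isLittleO ?_
    simpa using Asymptotics.isLittleO_pow_pow (𝕜 := ℝ) (m := 1) (n := k + 2) (by omega)
  · have : (fun s : ℝ => max s 0 ^ (k + 2)) =ᶠ[𝓝 s] fun s => s ^ (k + 2) := by
      filter_upwards [eventually_gt_nhds hs] with r hr
      rw [max_eq_left hr.le]
    have h2 := (hasDerivAt_pow (k + 2) s).congr_of_eventuallyEq this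
    rw [max_eq_left hs.le]
    simpa using h2

/-- Differentiation under the integral sign for a jointly continuous derivative. -/
theorem hasDerivAt_intervalIntegral_of_continuousOn {K K' : ℝ → ℝ → ℝ} {a b t₀ t₁ t : ℝ}
    (hab : a ≤ b) (ht : t ∈ Ioo t₀ t₁)
    (hK : ∀ s ∈ Icc t₀ t₁, ContinuousOn (K s) (Icc a b))
    (hK' : ContinuousOn (fun p : ℝ × ℝ => K' p.1 p.2) (Icc t₀ t₁ ×ˢ Icc a b))
    (hd : ∀ z ∈ Icc a b, ∀ s ∈ Icc t₀ t₁, HasDerivAt (fun s => K s z) (K' s z) s) :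
    HasDerivAt (fun s => ∫ z in a..b, K s z) (∫ z in a..b, K' t z) t := by
  obtain ⟨C, hC⟩ := (isCompact_Icc.prod isCompact_Icc).exists_bound_of_continuousOn hK'
  have hsub : uIoc a b ⊆ Icc a b := by rw [uIoc_of_le hab]; exact Ioc_subset_Icc_self
  have hnh : Icc t₀ t₁ ∈ 𝓝 t := Icc_mem_nhds ht.1 ht.2
  refine (intervalIntegral.hasDerivAt_integral_of_dominated_loc_of_deriv_le
    (bound := fun _ => C) (μ := MeasureTheory.volume) hnh ?_ ?_ ?_ ?_ ?_ ?_).2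
  · filter_upwards [hnh] with s hs
    exact ((hK s hs).mono hsub).aestronglyMeasurable measurableSet_uIoc
  · apply ContinuousOn.intervalIntegrable
    rw [uIcc_of_le hab]
    exact hK t (Ioo_subset_Icc_self ht)
  · have h1 : ContinuousOn (K' t) (Icc a b) :=
      hK'.comp (f := fun z => (t, z)) (by fun_prop) fun z hz => ⟨Ioo_subset_Icc_self ht, hz⟩
    exact (h1.mono hsub).aestronglyMeasurable measurableSet_uIoc
  · exact Eventually.of_forall fun z hz s hs => hC (s, z) ⟨hs, hsub hz⟩
  · exact intervalIntegrable_const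
  · exact Eventually.of_forall fun z hz s hs => hd z (hsub hz) s hs

namespace IsHalfLineCSF

variable {S m : ℝ} {f : ℝ → ℝ → ℝ}

theorem contDiffAt (h : IsHalfLineCSF S m f) {z t : ℝ} (hz : 0 < z) (ht : t ∈ Ioo 0 S) :
    ContDiffAt ℝ 2 (fun p : ℝ × ℝ => f p.1 p.2) (z, t) :=
  h.smooth.contDiffAt ((isOpen_Ioi.prod isOpen_Ioo).mem_nhds ⟨hz, ht⟩)

theorem hasDerivAt_time (h : IsHalfLineCSF S m f) {z t : ℝ} (hz : 0 < z) (ht : t ∈ Ioo 0 S) :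
    HasDerivAt (fun s => f z s) (fderiv ℝ (fun p : ℝ × ℝ => f p.1 p.2) (z, t) (0, 1)) t := by
  have h1 := ((h.contDiffAt hz ht).differentiableAt (by simp)).hasFDerivAt
  have h2 : HasDerivAt (fun s : ℝ => (z, s)) (0, 1) t :=
    (hasDerivAt_const t z).prodMk (hasDerivAt_id t)
  exact h1.comp_hasDerivAt t h2

/-- The excess area above a level which exceeds the boundary values does not increase. -/
theorem deriv_area_nonpos (h : IsHalfLineCSF S m f) {a b l t : ℝ} (ha : 0 < a) (hab : a ≤ b)
    (ht : t ∈ Ioo 0 S) (hla : f a t ≤ l) (hlb : f b t ≤ l) :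
    ∃ A' ≤ (0 : ℝ), HasDerivAt (fun s => ∫ z in a..b, max (f z s - l) 0 ^ 3) A' t := by
  set F : ℝ × ℝ → ℝ := fun p => f p.1 p.2 with hF
  obtain ⟨t₀, ht₀, ht₀'⟩ := exists_between ht.1
  obtain ⟨t₁, ht₁, ht₁'⟩ := exists_between ht.2
  have hpos : ∀ z ∈ Icc a b, 0 < z := fun z hz => ha.trans_le hz.1
  have htin : ∀ s ∈ Icc t₀ t₁, s ∈ Ioo 0 S := fun s hs =>
    ⟨ht₀.trans_le hs.1, hs.2.trans_lt ht₁'⟩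
  have hderiv := hasDerivAt_intervalIntegral_of_continuousOn (a := a) (b := b)
    (K := fun s z => max (f z s - l) 0 ^ 3)
    (K' := fun s z => 3 * max (f z s - l) 0 ^ 2 * fderiv ℝ F (z, s) (0, 1)) (t := t)
    (t₀ := t₀) (t₁ := t₁) hab ⟨ht₀', ht₁⟩ ?_ ?_ ?_
  · refine ⟨_, ?_, hderiv⟩
    have hsec : ∀ z ∈ Icc a b, ContDiffAt ℝ 2 (fun y => f y t) z := fun z hz => by
      have h1 := h.contDiffAt (hpos z hz) ht
      exact h1.comp z (f := fun y => (y, t)) (by fun_prop)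
    set p : ℝ → ℝ := deriv fun y => f y t with hp
    set q : ℝ → ℝ := deriv p with hq
    have hfz : ∀ z ∈ Icc a b, HasDerivAt (fun y => f y t) (p z) z := fun z hz =>
      (HasSecondDerivAt.of_contDiffAt (hsec z hz)).hasDerivAt
    have hp1 : ∀ z ∈ Icc a b, ContDiffAt ℝ 1 p z := fun z hz =>
      ((hsec z hz).fderiv_right (m := 1) (by norm_num)).clm_apply contDiffAt_const
    have hpz : ∀ z ∈ Icc a b, HasDerivAt p (q z) z := fun z hz =>
      ((hp1 z hz).differentiableAt (by simp)).hasDerivAt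
    have hqc : ContinuousOn q (Icc a b) := fun z hz => by
      have h1 : ContDiffAt ℝ 0 q z :=
        ((hp1 z hz).fderiv_right (m := 0) (by norm_num)).clm_apply contDiffAt_const
      exact h1.continuousAt.continuousWithinAt
    have hpc : ContinuousOn p (Icc a b) := fun z hz => (hpz z hz).continuousAt.continuousWithinAt
    have hfc : ContinuousOn (fun y => f y t) (Icc a b) := fun z hz =>
      (hfz z hz).continuousAt.continuousWithinAt
    have heq : ∀ z ∈ Icc a b, fderiv ℝ F (z, t) (0, 1) = q z / (1 + p z ^ 2) := by
      intro z hz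
      obtain ⟨ft, p', q', h1, h2, h3⟩ := h.isCSFAt z (hpos z hz) t ht
      rw [(h.hasDerivAt_time (hpos z hz) ht).unique h1, h3, ← h2.deriv_eq, ← h2.deriv_deriv_eq]
    -- Integration by parts for f_t = (arctan f')': this total derivative integrates to 0, since f ≤
    -- l at both ends, and its other term 6(f - l)₊ f' arctan f' is nonnegative. Cubing the excess
    -- makes the factor (f - l)₊² differentiable across the level l.
    have hprod : ∀ z ∈ Icc a b,
        HasDerivAt (fun z => 3 * max (f z t - l) 0 ^ 2 * Real.arctan (p z))
          (3 * (2 * max (f z t - l) 0 * p z) * Real.arctan (p z)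
            + 3 * max (f z t - l) 0 ^ 2 * (q z / (1 + p z ^ 2))) z := by
      intro z hz
      have h1 := (hasDerivAt_max_zero_pow 0 (f z t - l)).comp z ((hfz z hz).sub_const l)
      have h2 := (h1.const_mul 3).mul (hpz z hz).arctan
      refine h2.congr_deriv ?_
      simp only [Function.comp]
      push_cast
      ring
    have hint : ∀ k : ℝ → ℝ, ContinuousOn k (Icc a b) →
        IntervalIntegrable k MeasureTheory.volume a b := fun k hk => by
      apply ContinuousOn.intervalIntegrable
      rwa [uIcc_of_le hab]
    have hi1 := hint (fun z => 3 * (2 * max (f z t - l) 0 * p z) * Real.arctan (p z)) (by fun_prop)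
    have hi2 := hint (fun z => 3 * max (f z t - l) 0 ^ 2 * (q z / (1 + p z ^ 2))) (by
      have : ContinuousOn (fun z => q z / (1 + p z ^ 2)) (Icc a b) :=
        hqc.div (by fun_prop) fun z _ => by positivity
      fun_prop)
    have hFTC := intervalIntegral.integral_eq_sub_of_hasDerivAt (a := a) (b := b)
      (fun z hz => hprod z (by rwa [uIcc_of_le hab] at hz)) (hi1.add hi2)
    rw [intervalIntegral.integral_add hi1 hi2, max_eq_right (sub_nonpos.2 hla),
      max_eq_right (sub_nonpos.2 hlb)] at hFTC
    have hnn : 0 ≤ ∫ z in a..b, 3 * (2 * max (f z t - l) 0 * p z) * Real.arctan (p z) := by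
      refine intervalIntegral.integral_nonneg hab fun z _ => ?_
      have h1 : 0 ≤ p z * Real.arctan (p z) := by
        rcases le_total 0 (p z) with h0 | h0
        · exact mul_nonneg h0 (Real.arctan_nonneg.2 h0)
        · refine mul_nonneg_of_nonpos_of_nonpos h0 ?_
          simpa using Real.arctan_strictMono.monotone h0
      have h2 : 0 ≤ max (f z t - l) 0 := le_max_right _ _
      calc 0 ≤ 6 * (max (f z t - l) 0 * (p z * Real.arctan (p z))) := by positivity
        _ = _ := by ring
    have hcongr : ∫ z in a..b, 3 * max (f z t - l) 0 ^ 2 * fderiv ℝ F (z, t) (0, 1)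
        = ∫ z in a..b, 3 * max (f z t - l) 0 ^ 2 * (q z / (1 + p z ^ 2)) := by
      refine intervalIntegral.integral_congr fun z hz => ?_
      rw [uIcc_of_le hab] at hz
      simp only [heq z hz]
    rw [hcongr]
    simp only [ne_eq, OfNat.ofNat_ne_zero, not_false_eq_true, zero_pow, mul_zero, zero_mul,
      sub_zero] at hFTC
    linarith
  · intro s hs
    have : ContinuousOn (fun z => f z s) (Icc a b) :=
      h.continuousOn.comp (f := fun z => (z, s)) (by fun_prop) fun z hz =>
        ⟨(hpos z hz).le, htin s hs⟩
    fun_prop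
  · intro q hq
    have hq' := h.contDiffAt (hpos q.2 hq.2) (htin q.1 hq.1)
    have h1 : ContinuousAt (fun r : ℝ × ℝ => fderiv ℝ F (r.2, r.1) (0, 1)) q := by
      have h2 : ContinuousAt (fderiv ℝ F) (q.2, q.1) :=
        (hq'.fderiv_right (m := 1) (by norm_num)).continuousAt
      have h3 : ContinuousAt (fun r : ℝ × ℝ => fderiv ℝ F (r.2, r.1)) q :=
        h2.comp (f := fun r : ℝ × ℝ => (r.2, r.1)) (by fun_prop)
      exact h3.clm_apply continuousAt_const
    have h4 : ContinuousAt (fun r : ℝ × ℝ => f r.2 r.1) q :=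
      hq'.continuousAt.comp (f := fun r : ℝ × ℝ => (r.2, r.1)) (by fun_prop)
    have h5 : ContinuousAt (fun r : ℝ × ℝ =>
        3 * max (f r.2 r.1 - l) 0 ^ 2 * fderiv ℝ F (r.2, r.1) (0, 1)) q := by fun_prop
    exact h5.continuousWithinAt
  · intro z hz s hs
    have h1 := (hasDerivAt_max_zero_pow 1 (f z s - l)).comp s
      ((h.hasDerivAt_time (hpos z hz) (htin s hs)).sub_const l)
    refine h1.congr_deriv ?_
    simp only [hF]
    push_cast
    ring

end IsHalfLineCSF

namespace IsHalfLineCSF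

variable {S m : ℝ} {f : ℝ → ℝ → ℝ}

theorem continuousOn_section (h : IsHalfLineCSF S m f) {t : ℝ} (ht : t ∈ Ioo 0 S) :
    ContinuousOn (fun z => f z t) (Ici 0) :=
  h.continuousOn.comp (f := fun z => (z, t)) (by fun_prop) fun _ hz => ⟨hz, ht⟩

/-- Near the corner the solution is bounded by an integrable power of the distance. -/
theorem cube_le_rpow (h : IsHalfLineCSF S m f) {z t l σ : ℝ} (hz : 0 < z) (hσ : 0 < σ)
    (hσt : σ ^ 2 = t) (ht : t ∈ Ioo 0 S) (hl : 0 ≤ l) (hsmall : Real.pi * σ ≤ 2 * l) :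
    max (f z t - l) 0 ^ 3 ≤ 343 * σ ^ 3 * (Real.pi * σ / 2) ^ (1 / 2 : ℝ) * z ^ (-1 / 2 : ℝ) := by
  have hpi := Real.pi_pos
  have hrhs : 0 ≤ 343 * σ ^ 3 * (Real.pi * σ / 2) ^ (1 / 2 : ℝ) * z ^ (-1 / 2 : ℝ) := by positivity
  rcases le_total (f z t) l with hle | hle
  · rw [max_eq_right (sub_nonpos.2 hle)]
    simpa using hrhs
  rw [max_eq_left (sub_nonneg.2 hle)]
  -- σ = √t is the parabolic length scale. For z ≥ σ, `le_div` gives f ≤ πσ/2 ≤ l and there is no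
  -- excess; for z < σ the reaper with c = 1/σ gives f ≤ σ(1 - log sin(z/σ)).
  rcases le_or_gt σ z with hzσ | hzσ
  · have h1 := h.le_div hz ht
    have h2 : Real.pi * t / (2 * z) ≤ l := by
      rw [div_le_iff₀ (by positivity), ← hσt]
      calc Real.pi * σ ^ 2 = (Real.pi * σ) * σ := by ring
        _ ≤ (2 * l) * z := by gcongr
        _ = _ := by ring
    have h3 : f z t = l := le_antisymm (h1.trans h2) hle
    rw [h3]
    simpa using hrhs
  · set X := Real.pi * σ / 2 / z with hX
    have hXpos : 0 < X := by positivity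
    have hX1 : 1 ≤ X := by
      rw [hX, le_div_iff₀ hz]
      nlinarith [Real.pi_gt_three]
    have hθ : σ⁻¹ * z ≤ 1 := by
      rw [inv_mul_le_iff₀ hσ]; linarith
    have h1 := h.le_grimReaper (c := σ⁻¹) (inv_pos.2 hσ) hz
      (by linarith [Real.pi_gt_three]) ht
    have hsin : X⁻¹ ≤ Real.sin (σ⁻¹ * z) := by
      have := Real.mul_le_sin (x := σ⁻¹ * z) (by positivity) (by linarith [Real.pi_gt_three])
      calc X⁻¹ = 2 / Real.pi * (σ⁻¹ * z) := by rw [hX]; field_simp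
        _ ≤ _ := this
    -- The exponent 1/6 is chosen so that the cube grows like z^(-1/2), which is integrable at 0.
    have hlog : -Real.log (Real.sin (σ⁻¹ * z)) ≤ 6 * X ^ (1 / 6 : ℝ) := by
      have h2 := Real.log_le_log (inv_pos.2 hXpos) hsin
      rw [Real.log_inv] at h2
      have h3 := Real.log_le_rpow_div hXpos.le (ε := 1 / 6) (by norm_num)
      linarith
    have hXp : 1 ≤ X ^ (1 / 6 : ℝ) := Real.one_le_rpow hX1 (by norm_num)
    have h4 : f z t ≤ 7 * σ * X ^ (1 / 6 : ℝ) := by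
      have e : σ⁻¹ * t = σ := by rw [← hσt]; field_simp
      rw [inv_inv, e] at h1
      nlinarith
    have h5 : (7 * σ * X ^ (1 / 6 : ℝ)) ^ 3
        = 343 * σ ^ 3 * (Real.pi * σ / 2) ^ (1 / 2 : ℝ) * z ^ (-1 / 2 : ℝ) := by
      have e1 : (X ^ (1 / 6 : ℝ)) ^ 3 = X ^ (1 / 2 : ℝ) := by
        rw [← Real.rpow_natCast, ← Real.rpow_mul hXpos.le]; norm_num
      have e2 : X ^ (1 / 2 : ℝ) = (Real.pi * σ / 2) ^ (1 / 2 : ℝ) * z ^ (-1 / 2 : ℝ) := by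
        rw [hX, Real.div_rpow (by positivity) hz.le, div_eq_mul_inv, ← Real.rpow_neg hz.le]
        norm_num
      rw [mul_pow, e1, e2]
      ring
    rw [← h5]
    have : 0 ≤ f z t - l := sub_nonneg.2 hle
    gcongr
    linarith

/-- The margin δ and uniform continuity on [t₀, t₁] give a strip [0, a] on which f stays below m +
δ. The integrand vanishes there, so only [a, Z] matters, where f is C² and `deriv_area_nonpos`
applies. -/
theorem area_le_area (h : IsHalfLineCSF S m f) {δ Z t₀ t₁ : ℝ} (hδ : 0 < δ) (hZ : 0 < Z)
    (ht₀ : 0 < t₀) (ht : t₀ ≤ t₁) (ht₁ : t₁ < S)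
    (hfZ : ∀ s ∈ Icc t₀ t₁, f Z s ≤ m + δ) :
    ∫ z in (0 : ℝ)..Z, max (f z t₁ - (m + δ)) 0 ^ 3
      ≤ ∫ z in (0 : ℝ)..Z, max (f z t₀ - (m + δ)) 0 ^ 3 := by
  have htin : ∀ s ∈ Icc t₀ t₁, s ∈ Ioo 0 S := fun s hs =>
    ⟨ht₀.trans_le hs.1, hs.2.trans_lt ht₁⟩
  have hcont : ContinuousOn (fun p : ℝ × ℝ => f p.1 p.2) (Icc 0 Z ×ˢ Icc t₀ t₁) :=
    h.continuousOn.mono (prod_mono (fun z hz => hz.1) htin)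
  have huc := (isCompact_Icc.prod isCompact_Icc).uniformContinuousOn_of_continuous hcont
  obtain ⟨d, hd, hdf⟩ := Metric.uniformContinuousOn_iff.1 huc δ hδ
  set a := min (d / 2) Z with ha
  have hapos : 0 < a := lt_min (by positivity) hZ
  have haZ : a ≤ Z := min_le_right _ _
  have hlow : ∀ z ∈ Icc 0 a, ∀ s ∈ Icc t₀ t₁, f z s ≤ m + δ := by
    intro z hz s hs
    have h1 := hdf (z, s) ⟨⟨hz.1, hz.2.trans haZ⟩, hs⟩ (0, s) ⟨⟨le_rfl, hZ.le⟩, hs⟩ (by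
      rw [Prod.dist_eq]
      simp only [dist_self, Real.dist_eq, sub_zero, abs_of_nonneg hz.1]
      rw [max_eq_left hz.1]
      have := hz.2.trans (min_le_left _ _)
      linarith)
    rw [Real.dist_eq] at h1
    have h2 := h.boundary s (htin s hs)
    linarith [(abs_lt.1 h1).2]
  have hsplit : ∀ s ∈ Icc t₀ t₁, ∫ z in (0 : ℝ)..Z, max (f z s - (m + δ)) 0 ^ 3
      = ∫ z in a..Z, max (f z s - (m + δ)) 0 ^ 3 := by
    intro s hs
    have hc := h.continuousOn_section (htin s hs)
    have hc' : ContinuousOn (fun z => max (f z s - (m + δ)) 0 ^ 3) (Ici 0) := by fun_prop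
    have hi1 : IntervalIntegrable (fun z => max (f z s - (m + δ)) 0 ^ 3)
        MeasureTheory.volume 0 a := by
      apply (hc'.mono _).intervalIntegrable
      rw [uIcc_of_le hapos.le]; exact Icc_subset_Ici_self
    have hi2 : IntervalIntegrable (fun z => max (f z s - (m + δ)) 0 ^ 3)
        MeasureTheory.volume a Z := by
      apply (hc'.mono _).intervalIntegrable
      rw [uIcc_of_le haZ]; exact fun z hz => hapos.le.trans hz.1
    rw [← intervalIntegral.integral_add_adjacent_intervals hi1 hi2]
    have : ∫ z in (0 : ℝ)..a, max (f z s - (m + δ)) 0 ^ 3 = ∫ z in (0 : ℝ)..a, (0 : ℝ) := by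
      refine intervalIntegral.integral_congr fun z hz => ?_
      rw [uIcc_of_le hapos.le] at hz
      simp only [max_eq_right (sub_nonpos.2 (hlow z hz s hs))]
      norm_num
    rw [this]
    simp
  rw [hsplit t₀ ⟨le_rfl, ht⟩, hsplit t₁ ⟨ht, le_rfl⟩]
  choose! A' hA' hderiv using fun s (hs : s ∈ Icc t₀ t₁) =>
    h.deriv_area_nonpos (l := m + δ) hapos haZ (htin s hs)
      (hlow a ⟨hapos.le, le_rfl⟩ s hs) (hfZ s hs)
  refine antitoneOn_of_deriv_nonpos (convex_Icc t₀ t₁)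
    (fun s hs => (hderiv s hs).continuousAt.continuousWithinAt)
    (fun s hs => (hderiv s (interior_subset hs)).differentiableAt.differentiableWithinAt)
    (fun s hs => ?_) ⟨le_rfl, ht⟩ ⟨ht, le_rfl⟩ ht
  rw [(hderiv s (interior_subset hs)).deriv]
  exact hA' s (interior_subset hs)

/-- The solution stays below its boundary values if these are nonnegative. -/
theorem le_boundary (h : IsHalfLineCSF S m f) (hm : 0 ≤ m) {z t : ℝ} (hz : 0 < z)
    (ht : t ∈ Ioo 0 S) : f z t ≤ m := by
  have hpi := Real.pi_pos
  refine le_of_forall_pos_le_add fun δ hδ => ?_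
  by_contra! hlt
  -- Far enough out for `le_div` to give f(Z, s) ≤ δ at all times s ≤ t.
  set Z := z + Real.pi * t / (2 * δ) with hZ
  have htpos := ht.1
  have hquot : 0 < Real.pi * t / (2 * δ) := by positivity
  have hZpos : 0 < Z := by positivity
  have hfZ : ∀ s ∈ Ioc 0 t, f Z s ≤ m + δ := by
    intro s hs
    have h1 := h.le_div hZpos ⟨hs.1, hs.2.trans_lt ht.2⟩
    have h2 : Real.pi * s / (2 * Z) ≤ δ := by
      rw [div_le_iff₀ (by positivity)]
      have : Real.pi * t = δ * (2 * (Real.pi * t / (2 * δ))) := by field_simp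
      have h3 : Real.pi * s ≤ Real.pi * t := by gcongr; exact hs.2
      rw [hZ]
      nlinarith [mul_pos hδ hz]
    linarith
  set N : ℝ → ℝ := fun s => ∫ z in (0 : ℝ)..Z, max (f z s - (m + δ)) 0 ^ 3 with hN
  have hc : ∀ s ∈ Ioo 0 S, ContinuousOn (fun z => max (f z s - (m + δ)) 0 ^ 3) (Icc 0 Z) := by
    intro s hs
    have := (h.continuousOn_section hs).mono (Icc_subset_Ici_self : Icc 0 Z ⊆ Ici 0)
    fun_prop
  have hNpos : 0 < N t := by
    refine intervalIntegral.integral_pos hZpos (hc t ht) (fun y _ => by positivity)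
      ⟨z, ⟨hz.le, by linarith⟩, ?_⟩
    have : 0 < f z t - (m + δ) := by linarith
    exact pow_pos (lt_max_of_lt_left this) 3
  set I := ∫ y in (0 : ℝ)..Z, y ^ (-1 / 2 : ℝ) with hI
  -- Monotonicity is started at time σ² rather than at 0; the excess area at that time is
  -- O(σ^(7/2)).
  have hsmall : ∀ᶠ σ in 𝓝[>] (0 : ℝ), N t ≤ 343 * σ ^ 3 * (Real.pi * σ / 2) ^ (1 / 2 : ℝ) * I := by
    filter_upwards [Ioo_mem_nhdsGT (lt_min (Real.sqrt_pos.2 htpos)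
      (show 0 < 2 * δ / Real.pi by positivity))] with σ hσ
    have hσt : σ ^ 2 < t := by
      have := hσ.2.trans_le (min_le_left _ _)
      rwa [Real.lt_sqrt hσ.1.le] at this
    have hσδ : Real.pi * σ ≤ 2 * (m + δ) := by
      have := hσ.2.trans_le (min_le_right _ _)
      rw [lt_div_iff₀ hpi] at this
      linarith
    have hσ2 : 0 < σ ^ 2 := pow_pos hσ.1 2
    have hin : σ ^ 2 ∈ Ioo 0 S := ⟨hσ2, hσt.trans ht.2⟩
    have h1 : N t ≤ N (σ ^ 2) := h.area_le_area hδ hZpos hσ2 hσt.le ht.2 fun s hs =>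
      hfZ s ⟨hσ2.trans_le hs.1, hs.2⟩
    refine h1.trans ?_
    rw [hI, ← intervalIntegral.integral_const_mul]
    refine intervalIntegral.integral_mono_on_of_le_Ioo hZpos.le ?_ ?_ fun y hy => ?_
    · apply ContinuousOn.intervalIntegrable
      rw [uIcc_of_le hZpos.le]
      exact hc _ hin
    · exact (intervalIntegral.intervalIntegrable_rpow' (by norm_num)).const_mul _
    · exact h.cube_le_rpow hy.1 hσ.1 rfl hin (by positivity) hσδ
  have hlim : Tendsto (fun σ : ℝ => 343 * σ ^ 3 * (Real.pi * σ / 2) ^ (1 / 2 : ℝ) * I)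
      (𝓝[>] (0 : ℝ)) (𝓝 0) := by
    have : Continuous fun σ : ℝ => 343 * σ ^ 3 * (Real.pi * σ / 2) ^ (1 / 2 : ℝ) * I := by
      have : Continuous fun σ : ℝ => (Real.pi * σ / 2) ^ (1 / 2 : ℝ) :=
        (by fun_prop : Continuous fun σ : ℝ => Real.pi * σ / 2).rpow_const
          fun _ => Or.inr (by norm_num)
      fun_prop
    have h2 := (this.tendsto 0).mono_left (nhdsWithin_le_nhds (s := Ioi 0))
    simpa using h2
  exact absurd (ge_of_tendsto hlim hsmall) (not_le.2 hNpos)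

end IsHalfLineCSF

/-! ### The step solution: bounds and monotonicity in z. -/

namespace IsStepCSFSolution

variable {S : ℝ} {φ : ℝ → ℝ → ℝ}

theorem contDiffAt (h : IsStepCSFSolution S φ) {z t : ℝ} (hz : 0 < z) (ht : t ∈ Ioo 0 S) :
    ContDiffAt ℝ ∞ (fun p : ℝ × ℝ => φ p.1 p.2) (z, t) :=
  h.smooth.contDiffAt (prod_mem_nhds (Ici_mem_nhds hz) (isOpen_Ioo.mem_nhds ht))

theorem isCSFAt (h : IsStepCSFSolution S φ) {z t : ℝ} (hz : 0 < z) (ht : t ∈ Ioo 0 S) :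
    IsCSFAt φ z t := by
  have h0 := (h.contDiffAt hz ht).of_le (m := 2) ENat.LEInfty.out
  have h1 : ContDiffAt ℝ 2 (fun y => φ y t) z := h0.comp z (f := fun y => (y, t)) (by fun_prop)
  have h2 : ContDiffAt ℝ 2 (fun s => φ z s) t := h0.comp t (f := fun s => (z, s)) (by fun_prop)
  refine ⟨_, _, _, (h2.differentiableAt (by simp)).hasDerivAt,
    HasSecondDerivAt.of_contDiffAt h1, ?_⟩
  rw [h.equation z hz t ht, iteratedDeriv_succ, iteratedDeriv_one]

/-- The boundary value is -1; it is weakened to the bound 0 because `le_boundary` requires m ≥ 0. -/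
theorem isHalfLineCSF_sub_one (h : IsStepCSFSolution S φ) :
    IsHalfLineCSF S 0 (fun z t => φ z t - 1) where
  smooth := ((h.smooth.of_le ENat.LEInfty.out).mono
    (prod_mono Ioi_subset_Ici_self subset_rfl)).sub contDiffOn_const
  isCSFAt z hz t ht := (h.isCSFAt hz ht).sub_const 1
  continuousOn := h.smooth.continuousOn.sub continuousOn_const
  continuousOn_initial := h.initial_continuousOn.sub continuousOn_const
  initial z hz := by simp [h.initial z hz]
  boundary t ht := by simp [h.boundary t ht]

theorem isHalfLineCSF_one_sub (h : IsStepCSFSolution S φ) :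
    IsHalfLineCSF S 1 (fun z t => -(φ z t - 1)) where
  smooth := h.isHalfLineCSF_sub_one.smooth.neg
  isCSFAt z hz t ht := (h.isHalfLineCSF_sub_one.isCSFAt z hz t ht).neg
  continuousOn := h.isHalfLineCSF_sub_one.continuousOn.neg
  continuousOn_initial := h.isHalfLineCSF_sub_one.continuousOn_initial.neg
  initial z hz := by simp [h.initial z hz]
  boundary t ht := by simp [h.boundary t ht]

theorem nonneg (h : IsStepCSFSolution S φ) {z t : ℝ} (hz : 0 ≤ z) (ht : t ∈ Ioo 0 S) :
    0 ≤ φ z t := by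
  rcases hz.eq_or_lt with rfl | hz
  · exact (h.boundary t ht).ge
  · linarith [h.isHalfLineCSF_one_sub.le_boundary zero_le_one hz ht]

theorem le_one (h : IsStepCSFSolution S φ) {z t : ℝ} (hz : 0 ≤ z) (ht : t ∈ Ioo 0 S) :
    φ z t ≤ 1 := by
  rcases hz.eq_or_lt with rfl | hz
  · simp [h.boundary t ht]
  · linarith [h.isHalfLineCSF_sub_one.le_boundary le_rfl hz ht]

theorem one_sub_le (h : IsStepCSFSolution S φ) {z t : ℝ} (hz : 0 < z) (ht : t ∈ Ioo 0 S) :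
    1 - Real.pi * t / (2 * z) ≤ φ z t := by
  linarith [h.isHalfLineCSF_one_sub.le_div hz ht]

/-- A translate to the left starts no lower, is nonnegative at z = 0 where φ vanishes, and is within
ε of 1 far out, so comparison applies up to ε. -/
theorem le_add_left (h : IsStepCSFSolution S φ) {z d t : ℝ} (hz : 0 ≤ z) (hd : 0 < d)
    (ht : t ∈ Ioo 0 S) : φ z t ≤ φ (d + z) t := by
  have hpi := Real.pi_pos
  have htpos := ht.1
  refine le_of_forall_pos_le_add fun ε hε => ?_
  set Z := z + Real.pi * t / (2 * ε) with hZ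
  have hquot : 0 < Real.pi * t / (2 * ε) := by positivity
  -- Starting at t₀ > 0 avoids the corner: by `one_sub_le` the translate is then at least 1 - ε
  -- everywhere, and φ ≤ 1.
  set t₀ := min t (2 * d * ε / Real.pi) with ht₀
  have ht₀pos : 0 < t₀ := lt_min htpos (by positivity)
  have ht₀t : t₀ ≤ t := min_le_left _ _
  have htin : ∀ s ∈ Icc t₀ t, s ∈ Ioo 0 S := fun s hs =>
    ⟨ht₀pos.trans_le hs.1, hs.2.trans_lt ht.2⟩
  refine csf_comparison (f := φ) (g := fun z t => φ (d + z) t) (a := 0) (b := Z) (t₀ := t₀)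
    (t₁ := t) ?_ ?_ ?_ ?_ ?_ ?_ ?_ z ⟨hz, by linarith⟩ t ⟨ht₀t, le_rfl⟩
  · exact h.smooth.continuousOn.mono (prod_mono (fun z hz => hz.1) htin)
  · exact h.smooth.continuousOn.comp (f := fun p : ℝ × ℝ => (d + p.1, p.2)) (by fun_prop)
      fun p hp => ⟨add_nonneg hd.le hp.1.1, htin _ hp.2⟩
  · exact fun y hy s hs => h.isCSFAt hy.1 (htin s ⟨hs.1.le, hs.2⟩)
  · exact fun y hy s hs => (h.isCSFAt (add_pos hd hy.1) (htin s ⟨hs.1.le, hs.2⟩)).comp_add_left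
  · intro y hy
    have hin := htin t₀ ⟨le_rfl, ht₀t⟩
    have h1 := h.le_one hy.1 hin
    have h2 := h.one_sub_le (z := d + y) (by linarith [hy.1]) hin
    have h3 : Real.pi * t₀ / (2 * (d + y)) ≤ ε := by
      have h4 : t₀ ≤ 2 * d * ε / Real.pi := min_le_right _ _
      rw [le_div_iff₀ hpi] at h4
      rw [div_le_iff₀ (by linarith [hy.1])]
      nlinarith [mul_nonneg hε.le hy.1]
    linarith
  · intro s hs
    rw [h.boundary s (htin s hs)]
    linarith [h.nonneg (z := d + 0) (by linarith) (htin s hs)]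
  · intro s hs
    have h1 := h.le_one (z := Z) (by linarith) (htin s hs)
    have h2 := h.one_sub_le (z := d + Z) (by linarith) (htin s hs)
    have h3 : Real.pi * s / (2 * (d + Z)) ≤ ε := by
      rw [div_le_iff₀ (by linarith)]
      have h4 : Real.pi * t = ε * (2 * (Real.pi * t / (2 * ε))) := by field_simp
      have h5 : Real.pi * s ≤ Real.pi * t := by gcongr; exact hs.2
      rw [hZ]
      nlinarith [mul_nonneg hε.le hz, mul_pos hε hd]
    linarith

theorem monotoneOn (h : IsStepCSFSolution S φ) {t : ℝ} (ht : t ∈ Ioo 0 S) :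
    MonotoneOn (fun z => φ z t) (Ici 0) := by
  intro y hy z _ hyz
  rcases hyz.eq_or_lt with rfl | hlt
  · exact le_rfl
  · simpa using h.le_add_left (d := z - y) hy (sub_pos.2 hlt) ht

end IsStepCSFSolution

/-! ### The graph operator in a frame adapted to the gradient. -/

section Trace

variable {n : ℕ}

theorem sum_coord_smul_single (e : EuclideanSpace ℝ (Fin n)) :
    ∑ i, e i • EuclideanSpace.single i (1 : ℝ) = e := by
  simpa using (EuclideanSpace.basisFun (Fin n) ℝ).sum_repr e

theorem sum_coord_sq {e : EuclideanSpace ℝ (Fin n)} (he : ‖e‖ = 1) : ∑ i, e i ^ 2 = 1 := by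
  have := EuclideanSpace.real_norm_sq_eq e
  rw [he] at this
  linarith

theorem sum_bilin_left (B : EuclideanSpace ℝ (Fin n) →L[ℝ] EuclideanSpace ℝ (Fin n) →L[ℝ] ℝ)
    (e a : EuclideanSpace ℝ (Fin n)) :
    ∑ i, e i * B (EuclideanSpace.single i 1) a = B e a := by
  conv_rhs => rw [← sum_coord_smul_single e]
  simp

theorem sum_bilin_right (B : EuclideanSpace ℝ (Fin n) →L[ℝ] EuclideanSpace ℝ (Fin n) →L[ℝ] ℝ)
    (e a : EuclideanSpace ℝ (Fin n)) :
    ∑ i, e i * B a (EuclideanSpace.single i 1) = B a e := by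
  conv_rhs => rw [← sum_coord_smul_single e]
  simp

/-- The trace of a bilinear form over the orthogonal complement of a unit vector. -/
theorem sum_bilin_orthogonal
    (B : EuclideanSpace ℝ (Fin n) →L[ℝ] EuclideanSpace ℝ (Fin n) →L[ℝ] ℝ)
    {e : EuclideanSpace ℝ (Fin n)} (he : ‖e‖ = 1) :
    ∑ i, B (EuclideanSpace.single i 1 - e i • e) (EuclideanSpace.single i 1 - e i • e)
      = ∑ i, B (EuclideanSpace.single i 1) (EuclideanSpace.single i 1) - B e e := by
  have h1 := sum_bilin_left B e e
  have h2 := sum_bilin_right B e e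
  have h3 : ∑ i, e i ^ 2 * B e e = B e e := by rw [← Finset.sum_mul, sum_coord_sq he, one_mul]
  have : ∀ i, B (EuclideanSpace.single i 1 - e i • e) (EuclideanSpace.single i 1 - e i • e)
      = B (EuclideanSpace.single i 1) (EuclideanSpace.single i 1)
        - e i * B (EuclideanSpace.single i 1) e - e i * B e (EuclideanSpace.single i 1)
        + e i ^ 2 * B e e := by
    intro i
    simp only [map_sub, map_smul, sub_apply, smul_apply,
      smul_eq_mul]
    ring
  simp_rw [this]
  rw [Finset.sum_add_distrib, Finset.sum_sub_distrib, Finset.sum_sub_distrib, h1, h2, h3]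
  ring

theorem inner_single_sub_smul {e : EuclideanSpace ℝ (Fin n)} (he : ‖e‖ = 1) (i : Fin n) :
    inner ℝ e (EuclideanSpace.single i 1 - e i • e) = 0 := by
  simp [inner_sub_right, inner_smul_right, he, EuclideanSpace.inner_single_right]

theorem partialD_partialD {v : EuclideanSpace ℝ (Fin n) → ℝ} {x : EuclideanSpace ℝ (Fin n)}
    (hv : ContDiffAt ℝ 2 v x) (i j : Fin n) :
    partialD i (partialD j v) x
      = fderiv ℝ (fderiv ℝ v) x (EuclideanSpace.single i 1) (EuclideanSpace.single j 1) := by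
  have h1 : DifferentiableAt ℝ (fderiv ℝ v) x :=
    (hv.fderiv_right (m := 1) (by norm_num)).differentiableAt (by simp)
  have h2 := (h1.hasFDerivAt.clm_apply
    (hasFDerivAt_const (EuclideanSpace.single j (1 : ℝ)) x)).fderiv
  unfold partialD
  rw [h2]
  simp

/-- The operator of mean curvature flow, split into the second derivative along the gradient
direction `e` and those orthogonal to it. -/
theorem graphMCFOperator_eq {v : EuclideanSpace ℝ (Fin n) → ℝ} {x e : EuclideanSpace ℝ (Fin n)}
    {c : ℝ} (hv : ContDiffAt ℝ 2 v x) (he : ‖e‖ = 1)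
    (hD : ∀ a, fderiv ℝ v x a = c * inner ℝ e a) :
    graphMCFOperator v x
      = ∑ i, fderiv ℝ (fderiv ℝ v) x (EuclideanSpace.single i 1 - e i • e)
          (EuclideanSpace.single i 1 - e i • e)
        + fderiv ℝ (fderiv ℝ v) x e e / (1 + c ^ 2) := by
  set B := fderiv ℝ (fderiv ℝ v) x with hB
  have hp : ∀ i, partialD i v x = c * e i := fun i => by
    simp [partialD, hD, EuclideanSpace.inner_single_right]
  have hsum : ∑ k, partialD k v x ^ 2 = c ^ 2 := by
    simp_rw [hp, mul_pow]
    rw [← Finset.mul_sum, sum_coord_sq he, mul_one]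
  rw [sum_bilin_orthogonal B he]
  unfold graphMCFOperator
  simp_rw [hsum, partialD_partialD hv, hp, sub_mul, Finset.sum_sub_distrib]
  rw [← hB]
  have h1 : ∑ i, ∑ j, (if i = j then (1 : ℝ) else 0)
      * B (EuclideanSpace.single i 1) (EuclideanSpace.single j 1)
      = ∑ i, B (EuclideanSpace.single i 1) (EuclideanSpace.single i 1) := by
    simp
  have h2 : ∑ i, ∑ j, c * e i * (c * e j) / (1 + c ^ 2)
      * B (EuclideanSpace.single i 1) (EuclideanSpace.single j 1)
      = c ^ 2 / (1 + c ^ 2) * B e e := by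
    have : ∀ i j, c * e i * (c * e j) / (1 + c ^ 2)
        * B (EuclideanSpace.single i 1) (EuclideanSpace.single j 1)
        = c ^ 2 / (1 + c ^ 2) * (e i * (e j
          * B (EuclideanSpace.single i 1) (EuclideanSpace.single j 1))) := fun i j => by ring
    simp_rw [this, ← Finset.mul_sum, sum_bilin_right, sum_bilin_left]
  rw [h1, h2]
  have : 1 + c ^ 2 ≠ 0 := by positivity
  field_simp
  ring

theorem graphMCFOperator_neg (v : EuclideanSpace ℝ (Fin n) → ℝ) (x : EuclideanSpace ℝ (Fin n)) :
    graphMCFOperator (fun y => -v y) x = -graphMCFOperator v x := by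
  have h1 : ∀ (i : Fin n) (w : EuclideanSpace ℝ (Fin n) → ℝ),
      partialD i (fun y => -w y) = fun y => -partialD i w y := by
    intro i w
    funext y
    simp [partialD, fderiv_fun_neg]
  unfold graphMCFOperator
  simp_rw [h1, neg_sq, neg_mul_neg, ← Finset.sum_neg_distrib, mul_neg]

end Trace

/-! ### The sum of principal curvatures as a trace of the Hessian. -/

section Curvature

variable {n : ℕ} {ρ : EuclideanSpace ℝ (Fin n) → ℝ} {x : EuclideanSpace ℝ (Fin n)}

theorem inner_gradient_eq_fderiv (ρ : EuclideanSpace ℝ (Fin n) → ℝ)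
    (x a : EuclideanSpace ℝ (Fin n)) : inner ℝ (∇ ρ x) a = fderiv ℝ ρ x a := by
  rw [← toDual_gradient, InnerProductSpace.toDual_apply_apply]

theorem inner_fderiv_gradient (hρ : ContDiffAt ℝ 2 ρ x) (a b : EuclideanSpace ℝ (Fin n)) :
    inner ℝ (fderiv ℝ (∇ ρ) x a) b = fderiv ℝ (fderiv ℝ ρ) x a b := by
  have h1 : DifferentiableAt ℝ (fderiv ℝ ρ) x :=
    (hρ.fderiv_right (m := 1) (by norm_num)).differentiableAt (by simp)
  -- `toDual` is conjugate-linear; over ℝ its inverse is repackaged as a linear map so that the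
  -- chain rule applies.
  let L : StrongDual ℝ (EuclideanSpace ℝ (Fin n)) →L[ℝ] EuclideanSpace ℝ (Fin n) :=
    LinearMap.mkContinuous
      { toFun := (InnerProductSpace.toDual ℝ (EuclideanSpace ℝ (Fin n))).symm
        map_add' := map_add _
        map_smul' := fun c f => by simp } 1 (fun f => by simp)
  have h2 : HasFDerivAt (∇ ρ) (L.comp (fderiv ℝ (fderiv ℝ ρ) x)) x :=
    L.hasFDerivAt.comp x h1.hasFDerivAt
  rw [h2.fderiv]
  exact InnerProductSpace.toDual_symm_apply

theorem starProjection_levelTangent {e : EuclideanSpace ℝ (Fin n)} {α : ℝ} (he : ‖e‖ = 1)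
    (hα : α ≠ 0) (hg : ∇ ρ x = α • e) (a : EuclideanSpace ℝ (Fin n)) :
    ((levelTangent ρ x).orthogonalProjectionOnto a : EuclideanSpace ℝ (Fin n))
      = a - inner ℝ e a • e := by
  have hspan : Submodule.span ℝ {∇ ρ x} = Submodule.span ℝ {e} := by
    rw [hg, Submodule.span_singleton_smul_eq (IsUnit.mk0 α hα)]
  have h1 := (Submodule.span ℝ {∇ ρ x}).starProjection_orthogonal_val a
  rw [Submodule.starProjection_apply] at h1
  rw [h1]
  simp only [hspan]
  rw [Submodule.starProjection_unit_singleton ℝ he]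

/-- Symmetry of the Hessian makes the shape operator symmetric, so its characteristic polynomial
splits over ℝ and the roots add up to the trace. Cyclicity of the trace moves the computation from
the tangent space to the whole space and its standard basis. -/
theorem sum_principalCurvatures {e : EuclideanSpace ℝ (Fin n)} {α : ℝ}
    (hρ : ContDiffAt ℝ 2 ρ x) (he : ‖e‖ = 1) (hα : α ≠ 0) (hg : ∇ ρ x = α • e) :
    (principalCurvatures ρ x).sum = ‖∇ ρ x‖⁻¹ *
      ∑ i, fderiv ℝ (fderiv ℝ ρ) x (EuclideanSpace.single i 1 - e i • e)
          (EuclideanSpace.single i 1 - e i • e) := by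
  set H := fderiv ℝ (fderiv ℝ ρ) x with hH
  have hsymmH : ∀ a b, H a b = H b a := fun a b => hρ.isSymmSndFDerivAt (by simp) a b
  have hsymm : (shapeOperator ρ x).IsSymmetric := by
    intro a b
    have h1 : ∀ a b : levelTangent ρ x, inner ℝ (shapeOperator ρ x a) b
        = ‖∇ ρ x‖⁻¹ * H a b := by
      intro a b
      simp only [shapeOperator, LinearMap.smul_apply, LinearMap.comp_apply, inner_smul_left,
        Submodule.subtype_apply, ContinuousLinearMap.coe_coe,
        Submodule.inner_orthogonalProjectionOnto_eq_of_mem_right]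
      rw [inner_fderiv_gradient hρ]
      simp [hH]
    rw [h1, real_inner_comm, h1, hsymmH]
  unfold principalCurvatures
  rw [← Module.End.trace_eq_sum_roots_charpoly_of_splits hsymm.splits_charpoly]
  unfold shapeOperator
  rw [map_smul, smul_eq_mul, LinearMap.trace_comp_comm',
    LinearMap.trace_eq_sum_inner _ (EuclideanSpace.basisFun (Fin n) ℝ),
    sum_bilin_orthogonal H he, ← sum_bilin_right H e e, ← Finset.sum_sub_distrib]
  congr 1
  refine Finset.sum_congr rfl fun i _ => ?_
  simp only [LinearMap.comp_apply, Submodule.subtype_apply, ContinuousLinearMap.coe_coe,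
    starProjection_levelTangent he hα hg, EuclideanSpace.basisFun_apply]
  rw [real_inner_comm, inner_fderiv_gradient hρ, ← hH]
  simp [EuclideanSpace.inner_single_right]

end Curvature

/-! ### Second-order inequalities at a maximum of the two-point function. -/

section Touching

variable {n : ℕ}

theorem MonotoneOn.nonneg_of_hasSecondDerivAt {ψ : ℝ → ℝ} {p q r : ℝ}
    (hψ : MonotoneOn ψ (Ici 0)) (hr : 0 < r) (h : HasSecondDerivAt ψ p q r) : 0 ≤ p :=
  h.hasDerivAt.nonneg_of_forall_le_left hr fun _ hs => hψ hs.1 hr.le hs.2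

/-- First and second derivatives of `v` at a point where it is touched from above by a radial
function `ψ(|y - x|)` plus a constant. -/
theorem derivs_of_radial_touching {v : EuclideanSpace ℝ (Fin n) → ℝ} {ψ : ℝ → ℝ}
    {x y e : EuclideanSpace ℝ (Fin n)} {p q r : ℝ} (hv : ContDiffAt ℝ 2 v y) (he : ‖e‖ = 1)
    (hr : 0 < r) (hyx : y - x = r • e) (hψ : MonotoneOn ψ (Ici 0))
    (hψ2 : HasSecondDerivAt ψ p q r)
    (hmax : ∀ᶠ y' in 𝓝 y, v y' - ψ ‖y' - x‖ ≤ v y - ψ r) :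
    (∀ a, fderiv ℝ v y a = p * inner ℝ e a) ∧ fderiv ℝ (fderiv ℝ v) y e e ≤ q ∧
      ∀ w, inner ℝ e w = 0 → fderiv ℝ (fderiv ℝ v) y w w ≤ p * ‖w‖ ^ 2 / r := by
  have hline : ∀ a : EuclideanSpace ℝ (Fin n), ∀ᶠ s : ℝ in 𝓝 0,
      v (y + s • a) - ψ ‖y + s • a - x‖ ≤ v y - ψ r := by
    intro a
    have hc : ContinuousAt (fun s : ℝ => y + s • a) 0 := by fun_prop
    refine hc.eventually (p := fun y' => v y' - ψ ‖y' - x‖ ≤ v y - ψ r) ?_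
    simpa only [zero_smul, add_zero] using hmax
  have hdir : fderiv ℝ v y e = p ∧ fderiv ℝ (fderiv ℝ v) y e e ≤ q := by
    have h1 : HasSecondDerivAt (fun s => ψ (r + 1 * s)) (p * 1) (q * 1 * 1 + p * 0) 0 :=
      HasSecondDerivAt.comp (g := fun s => r + 1 * s) (by simpa using hψ2)
        (HasSecondDerivAt.affine r 1 0)
    have h2 := (hv.hasSecondDerivAt_line e).touching h1 (by
      filter_upwards [hline e, eventually_gt_nhds (neg_lt_zero.2 hr)] with s hs hs'
      have e1 : ‖y + s • e - x‖ = r + 1 * s := by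
        rw [show y + s • e - x = (r + 1 * s) • e by
          rw [add_sub_right_comm, hyx, ← add_smul, one_mul], norm_smul, he, mul_one,
          Real.norm_eq_abs, abs_of_nonneg (by linarith)]
      rw [e1] at hs
      simpa using hs)
    simpa using h2
  have horth : ∀ w, inner ℝ e w = 0 → fderiv ℝ v y w = 0 ∧
      fderiv ℝ (fderiv ℝ v) y w w ≤ p * ‖w‖ ^ 2 / r := by
    intro w hw
    -- Then r + μs² ≥ √(r² + s²|w|²) with equality at s = 0, and monotonicity of ψ allows this
    -- smooth majorant of the distance.
    set μ := ‖w‖ ^ 2 / (2 * r) with hμ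
    have h1 : HasSecondDerivAt (fun s => ψ (r + μ * s ^ 2)) (p * 0)
        (q * 0 * 0 + p * (2 * μ)) 0 :=
      HasSecondDerivAt.comp (g := fun s => r + μ * s ^ 2) (by simpa using hψ2)
        (HasSecondDerivAt.quadratic r μ)
    have hμ0 : 0 ≤ μ := by positivity
    have h2 := (hv.hasSecondDerivAt_line w).touching h1 (by
      filter_upwards [hline w] with s hs
      have e1 : ‖y + s • w - x‖ ≤ r + μ * s ^ 2 := by
        have hnn : 0 ≤ r + μ * s ^ 2 := by positivity
        rw [show y + s • w - x = r • e + s • w by rw [add_sub_right_comm, hyx]]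
        refine le_of_sq_le_sq ?_ hnn
        rw [norm_add_sq_real, norm_smul, norm_smul, inner_smul_left, inner_smul_right, hw, he]
        simp only [Real.norm_eq_abs, mul_pow, sq_abs, mul_zero, mul_one, add_zero]
        have e2 : r * μ * 2 = ‖w‖ ^ 2 := by rw [hμ]; field_simp
        nlinarith [sq_nonneg (μ * s ^ 2), sq_nonneg s]
      have e2 := hψ (norm_nonneg _) (show (0 : ℝ) ≤ r + μ * s ^ 2 by positivity) e1
      simp only [zero_smul, add_zero, ne_eq, OfNat.ofNat_ne_zero, not_false_eq_true, zero_pow,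
        mul_zero]
      linarith)
    refine ⟨by simpa using h2.1, h2.2.trans (le_of_eq ?_)⟩
    rw [hμ]
    field_simp
    ring
  refine ⟨fun a => ?_, hdir.2, fun w hw => (horth w hw).2⟩
  have h1 := (horth (a - inner ℝ e a • e) (by
    simp [inner_sub_right, inner_smul_right, he])).1
  rw [map_sub, map_smul, hdir.1, smul_eq_mul] at h1
  linarith

/-- The operators at an interior maximum of the two-point function. -/
theorem graphMCFOperator_sub_le_of_interior_max {Ω : Set (EuclideanSpace ℝ (Fin n))}
    (hΩ : IsOpen Ω) {v : EuclideanSpace ℝ (Fin n) → ℝ} {ψ : ℝ → ℝ}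
    {x y : EuclideanSpace ℝ (Fin n)} {p q : ℝ} (hx : x ∈ Ω) (hy : y ∈ Ω) (hxy : x ≠ y)
    (hvx : ContDiffAt ℝ 2 v x) (hvy : ContDiffAt ℝ 2 v y) (hψ : MonotoneOn ψ (Ici 0))
    (hψ2 : HasSecondDerivAt ψ p q ‖y - x‖)
    (hmax : ∀ x' ∈ Ω, ∀ y' ∈ Ω, v y' - v x' - ψ ‖y' - x'‖ ≤ v y - v x - ψ ‖y - x‖) :
    graphMCFOperator v y - graphMCFOperator v x ≤ q / (1 + p ^ 2) := by
  set r := ‖y - x‖ with hr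
  have hrpos : 0 < r := norm_pos_iff.2 (sub_ne_zero.2 hxy.symm)
  set e := r⁻¹ • (y - x) with he
  have hyx : y - x = r • e := by rw [he, smul_inv_smul₀ hrpos.ne']
  have he1 : ‖e‖ = 1 := by
    rw [he, norm_smul, norm_inv, norm_norm, ← hr, inv_mul_cancel₀ hrpos.ne']
  obtain ⟨hDy, hBy, -⟩ := derivs_of_radial_touching hvy he1 hrpos hyx hψ hψ2 (by
    filter_upwards [hΩ.mem_nhds hy] with y' hy'
    linarith [hmax x hx y' hy'])
  obtain ⟨hDx, hBx, -⟩ := derivs_of_radial_touching (v := fun z => -v z) (x := y) (y := x)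
    (e := -e) hvx.neg (by rw [norm_neg, he1]) hrpos
    (by rw [smul_neg, ← hyx, neg_sub]) hψ hψ2 (by
    filter_upwards [hΩ.mem_nhds hx] with x' hx'
    have := hmax x' hx' y hy
    rw [norm_sub_rev y x'] at this
    linarith)
  have hneg : fderiv ℝ (fun z => -v z) = fun z => -fderiv ℝ v z := by
    funext z; exact fderiv_fun_neg
  have hDx' : ∀ a, fderiv ℝ v x a = p * inner ℝ e a := by
    intro a
    have := hDx a
    rw [hneg] at this
    simp only [neg_apply, inner_neg_left, mul_neg, neg_inj] at this
    exact this
  have hBx' : -fderiv ℝ (fderiv ℝ v) x e e ≤ q := by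
    rw [hneg, fderiv_fun_neg] at hBx
    simpa using hBx
  -- Both points move by the same vector, so the distance and the term ψ stay fixed.
  have hQ : ∀ w, fderiv ℝ (fderiv ℝ v) y w w ≤ fderiv ℝ (fderiv ℝ v) x w w := by
    intro w
    refine ((hvy.hasSecondDerivAt_line w).touching (hvx.hasSecondDerivAt_line w) ?_).2
    have hc : ∀ z ∈ Ω, ∀ᶠ s : ℝ in 𝓝 0, z + s • w ∈ Ω := by
      intro z hz
      have hc : ContinuousAt (fun s : ℝ => z + s • w) 0 := by fun_prop
      exact hc.eventually_mem (hΩ.mem_nhds (by simpa using hz))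
    filter_upwards [hc x hx, hc y hy] with s h1 h2
    have := hmax _ h1 _ h2
    rw [add_sub_add_right_eq_sub, ← hr] at this
    simp only [zero_smul, add_zero]
    linarith
  rw [graphMCFOperator_eq hvy he1 hDy, graphMCFOperator_eq hvx he1 hDx']
  have h1 := Finset.sum_le_sum fun i (_ : i ∈ Finset.univ) =>
    hQ (EuclideanSpace.single i 1 - e i • e)
  have h2 : (fderiv ℝ (fderiv ℝ v) y e e - fderiv ℝ (fderiv ℝ v) x e e) / (1 + p ^ 2)
      ≤ q / (1 + p ^ 2) := by
    gcongr
    have := hQ e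
    -- The difference along e is at most 0 (parallel motion) and at most 2q (separate motions),
    -- hence at most q for either sign of q.
    rcases le_total 0 q with h0 | h0 <;> linarith
  rw [sub_div] at h2
  linarith

/-- A segment from a point of an open set to a point outside meets the frontier. -/
theorem exists_mem_frontier_norm_sub_le {Ω : Set (EuclideanSpace ℝ (Fin n))} (hΩ : IsOpen Ω)
    {x y : EuclideanSpace ℝ (Fin n)} (hy : y ∈ Ω) (hx : x ∉ Ω) :
    ∃ z ∈ frontier Ω, ‖y - z‖ ≤ ‖y - x‖ := by
  by_contra! hcon
  have hdisj : segment ℝ y x ⊆ Ω ∪ (closure Ω)ᶜ := by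
    intro z hz
    by_contra hz'
    rw [mem_union, not_or, mem_compl_iff, not_not] at hz'
    have h1 := hcon z ⟨hz'.2, by rw [hΩ.interior_eq]; exact hz'.1⟩
    obtain ⟨θ, hθ, rfl⟩ := (segment_eq_image' ℝ y x ▸ hz :)
    rw [show y - (y + θ • (x - y)) = θ • (y - x) by module, norm_smul, Real.norm_eq_abs,
      abs_of_nonneg hθ.1] at h1
    nlinarith [norm_nonneg (y - x), hθ.2]
  have := (convex_segment y x).isPreconnected.subset_left_of_subset_union hΩ
    isClosed_closure.isOpen_compl
    (disjoint_compl_right.mono_left subset_closure) hdisj ⟨y, left_mem_segment ℝ y x, hy⟩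
  exact hx (this (right_mem_segment ℝ y x))

theorem IsLocalDefiningFunction.contDiffAt {Ω U : Set (EuclideanSpace ℝ (Fin n))}
    {x : EuclideanSpace ℝ (Fin n)} {ρ : EuclideanSpace ℝ (Fin n) → ℝ}
    (h : IsLocalDefiningFunction Ω x U ρ) : ContDiffAt ℝ 2 ρ x :=
  h.contDiffOn.contDiffAt (h.isOpen.mem_nhds h.mem)

theorem IsLocalDefiningFunction.eq_zero {Ω U : Set (EuclideanSpace ℝ (Fin n))}
    {x : EuclideanSpace ℝ (Fin n)} {ρ : EuclideanSpace ℝ (Fin n) → ℝ} (hΩ : IsOpen Ω)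
    (h : IsLocalDefiningFunction Ω x U ρ) (hx : x ∈ frontier Ω) : ρ x = 0 := by
  have hxΩ : x ∉ Ω := fun hx' => by
    rw [hΩ.frontier_eq] at hx
    exact hx.2 hx'
  refine le_antisymm ?_ (not_lt.1 fun hlt => hxΩ ((h.mem_iff x h.mem).2 hlt))
  by_contra! hpos
  have hev : ∀ᶠ y in 𝓝 x, 0 < ρ y ∧ y ∈ U :=
    (h.contDiffAt.continuousAt.eventually_const_lt hpos).and (h.isOpen.mem_nhds h.mem)
  obtain ⟨y, hy3, hy1, hy2⟩ :=
    ((mem_closure_iff_frequently.1 hx.1).and_eventually hev).exists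
  exact absurd ((h.mem_iff y hy2).1 hy3) (not_lt.2 hy1.le)

/-- If a ball inside `Ω` touches the boundary at `x`, then the gradient of a defining function at
`x` points away from the centre. -/
theorem IsLocalDefiningFunction.gradient_eq_of_ball_subset {Ω U : Set (EuclideanSpace ℝ (Fin n))}
    {x y e : EuclideanSpace ℝ (Fin n)} {ρ : EuclideanSpace ℝ (Fin n) → ℝ} {r : ℝ} (hΩ : IsOpen Ω)
    (h : IsLocalDefiningFunction Ω x U ρ) (hx : x ∈ frontier Ω) (he : ‖e‖ = 1) (hr : 0 < r)
    (hyx : y - x = r • e) (hball : Metric.ball y r ⊆ Ω) :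
    ∃ α : ℝ, α < 0 ∧ ∇ ρ x = α • e := by
  have hρ0 := h.eq_zero hΩ hx
  set g := ∇ ρ x with hg
  have hg0 : g ≠ 0 := h.gradient_ne_zero x h.mem
  -- Such a direction a enters the ball, hence Ω, where ρ < 0.
  have hkey : ∀ a, 0 < inner ℝ e a → inner ℝ g a ≤ 0 := by
    intro a ha
    have hd : HasDerivAt (fun s : ℝ => ρ (x + s • (-a))) (fderiv ℝ ρ x (-a)) 0 :=
      (h.contDiffAt.hasSecondDerivAt_line (-a)).hasDerivAt
    have hcU : ∀ᶠ s : ℝ in 𝓝 0, x + s • (-a) ∈ U := by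
      have hc : ContinuousAt (fun s : ℝ => x + s • (-a)) 0 := by fun_prop
      exact hc.eventually_mem (h.isOpen.mem_nhds (by simpa using h.mem))
    have hsmall : ∀ᶠ s : ℝ in 𝓝 0, -s * ‖a‖ ^ 2 < 2 * r * inner ℝ e a := by
      have hc : ContinuousAt (fun s : ℝ => -s * ‖a‖ ^ 2) 0 := by fun_prop
      refine hc.eventually_lt_const ?_
      simp only [neg_zero, zero_mul]
      positivity
    obtain ⟨l, hl, hl'⟩ := mem_nhdsLE_iff_exists_Icc_subset.1
      (mem_nhdsWithin_of_mem_nhds (t := Iic (0 : ℝ)) (hcU.and hsmall))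
    have h1 := hd.nonneg_of_forall_le_left hl fun s hs => by
      simp only [zero_smul, add_zero, hρ0]
      rcases hs.2.eq_or_lt with rfl | hneg
      · simp [hρ0]
      obtain ⟨hsU, hss⟩ := hl' hs
      refine ((h.mem_iff _ hsU).1 (hball ?_)).le
      rw [Metric.mem_ball, dist_comm, dist_eq_norm,
        show y - (x + s • -a) = r • e + s • a by rw [← hyx, smul_neg]; abel]
      refine lt_of_pow_lt_pow_left₀ 2 hr.le ?_
      rw [norm_add_sq_real, norm_smul, norm_smul, inner_smul_left, inner_smul_right, he]
      simp only [Real.norm_eq_abs, mul_pow, sq_abs, mul_one, conj_trivial]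
      nlinarith
    rw [← inner_gradient_eq_fderiv, inner_neg_right] at h1
    linarith
  set α := inner ℝ e g with hα
  have hee : inner ℝ e e = (1 : ℝ) := by simp [he]
  have hα0 : α ≤ 0 := by
    have := hkey e (by rw [hee]; exact one_pos)
    rwa [real_inner_comm] at this
  set w := g - α • e with hw
  have hew : inner ℝ e w = 0 := by rw [hw, inner_sub_right, inner_smul_right, hee, ← hα]; ring
  have hgw : inner ℝ g w = ‖w‖ ^ 2 := by
    have : g = w + α • e := by rw [hw]; abel
    conv_lhs => rw [this]
    rw [inner_add_left, inner_smul_left, hew, real_inner_self_eq_norm_sq]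
    simp
  have hw0 : ‖w‖ ^ 2 ≤ 0 := by
    refine le_of_forall_pos_le_add fun ε hε => ?_
    have hη : 0 < ε / (1 - α) := div_pos hε (by linarith)
    -- The tangential part w of the gradient, tilted slightly inwards to be admissible in `hkey`.
    have h1 := hkey (w + (ε / (1 - α)) • e) (by
      rw [inner_add_right, hew, inner_smul_right, hee]; simpa using hη)
    rw [inner_add_right, hgw, inner_smul_right, real_inner_comm, ← hα] at h1
    have h2 : ε / (1 - α) * (1 - α) = ε := div_mul_cancel₀ _ (by linarith)
    nlinarith
  have hgα : g = α • e := by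
    have : w = 0 := by
      rw [← norm_eq_zero]
      exact pow_eq_zero_iff (two_ne_zero) |>.1 (le_antisymm hw0 (sq_nonneg _))
    rw [hw, sub_eq_zero] at this
    exact this
  refine ⟨α, hα0.lt_of_ne fun h0 => hg0 ?_, hgα⟩
  rw [hgα, h0, zero_smul]

/-- The operator at a maximum of the two-point function with one point on the boundary of a
mean-convex domain. -/
theorem graphMCFOperator_le_of_boundary_max {Ω : Set (EuclideanSpace ℝ (Fin n))}
    (hΩ : IsOpen Ω) (hΩ2 : HasC2Boundary Ω) (hΩm : IsMeanConvex Ω)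
    {v : EuclideanSpace ℝ (Fin n) → ℝ} {ψ : ℝ → ℝ}
    {x y : EuclideanSpace ℝ (Fin n)} {p q : ℝ} (hx : x ∈ frontier Ω) (hy : y ∈ Ω)
    (hvy : ContDiffAt ℝ 2 v y) (hψ : MonotoneOn ψ (Ici 0))
    (hψ2 : HasSecondDerivAt ψ p q ‖y - x‖)
    (hmax : ∀ x' ∈ frontier Ω, ∀ y' ∈ Ω, v y' - ψ ‖y' - x'‖ ≤ v y - ψ ‖y - x‖) :
    graphMCFOperator v y ≤ q / (1 + p ^ 2) := by
  have hxΩ : x ∉ Ω := fun hx' => by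
    rw [hΩ.frontier_eq] at hx
    exact hx.2 hx'
  have hxy : x ≠ y := fun h => hxΩ (h ▸ hy)
  set r := ‖y - x‖ with hr
  have hrpos : 0 < r := norm_pos_iff.2 (sub_ne_zero.2 hxy.symm)
  set e := r⁻¹ • (y - x) with he
  have hyx : y - x = r • e := by rw [he, smul_inv_smul₀ hrpos.ne']
  have he1 : ‖e‖ = 1 := by
    rw [he, norm_smul, norm_inv, norm_norm, ← hr, inv_mul_cancel₀ hrpos.ne']
  obtain ⟨hDy, hBy, hBw⟩ := derivs_of_radial_touching hvy he1 hrpos hyx hψ hψ2 (by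
    filter_upwards [hΩ.mem_nhds hy] with y' hy'
    exact hmax x hx y' hy')
  -- The segment from y' to an exterior point meets the frontier no farther away, so monotonicity of
  -- ψ extends maximality to all points outside Ω. Boundary variations thus need only stay outside
  -- Ω.
  have hmax' : ∀ x' ∉ Ω, ∀ y' ∈ Ω, v y' - ψ ‖y' - x'‖ ≤ v y - ψ r := by
    intro x' hx' y' hy'
    obtain ⟨z, hz, hzle⟩ := exists_mem_frontier_norm_sub_le hΩ hy' hx'
    have := hψ (norm_nonneg _) (norm_nonneg (y' - x')) hzle
    linarith [hmax z hz y' hy']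
  have hp0 : 0 ≤ p := hψ.nonneg_of_hasSecondDerivAt hrpos hψ2
  rw [graphMCFOperator_eq hvy he1 hDy]
  have hee : fderiv ℝ (fderiv ℝ v) y e e / (1 + p ^ 2) ≤ q / (1 + p ^ 2) := by gcongr
  suffices hsum : ∑ i, fderiv ℝ (fderiv ℝ v) y (EuclideanSpace.single i 1 - e i • e)
      (EuclideanSpace.single i 1 - e i • e) ≤ 0 by linarith
  rcases hp0.eq_or_lt with hp | hp
  · refine Finset.sum_nonpos fun i _ => ?_
    have := hBw _ (inner_single_sub_smul he1 i)
    simpa [← hp] using this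
  -- A point outside Ω closer to y than r would make ψ constant just below r, contradicting p > 0.
  have hball : Metric.ball y r ⊆ Ω := by
    intro x' hx'
    by_contra hx'Ω
    rw [Metric.mem_ball, dist_comm, dist_eq_norm] at hx'
    have h1 : ψ r ≤ ψ ‖y - x'‖ := by linarith [hmax' x' hx'Ω y hy]
    have h2 := hψ2.neg.hasDerivAt.nonneg_of_forall_le_left hx' fun s hs => by
      have := hψ (norm_nonneg (y - x')) (show (0 : ℝ) ≤ s from (norm_nonneg _).trans hs.1) hs.1
      linarith
    linarith
  obtain ⟨U, ρ, hρ⟩ := hΩ2 x hx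
  obtain ⟨α, hα, hg⟩ := hρ.gradient_eq_of_ball_subset hΩ hx he1 hrpos hyx hball
  have hρ0 := hρ.eq_zero hΩ hx
  have hDρ : ∀ a, fderiv ℝ ρ x a = α * inner ℝ e a := fun a => by
    rw [← inner_gradient_eq_fderiv, hg, inner_smul_left]; simp
  have hcurv : ∀ w, inner ℝ e w = 0 →
      fderiv ℝ (fderiv ℝ v) y w w ≤ p / α * fderiv ℝ (fderiv ℝ ρ) x w w := by
    intro w hw
    set Hw := fderiv ℝ (fderiv ℝ ρ) x w w with hHw
    refine le_of_forall_pos_le_add fun ε hε => ?_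
    set μ := Hw / (2 * α) + ε / (2 * p) with hμ
    have h1 := hρ.contDiffAt.hasSecondDerivAt_parabola w (-μ • e)
    have e1 : fderiv ℝ ρ x w = 0 := by rw [hDρ, hw, mul_zero]
    have e2 : Hw + 2 * fderiv ℝ ρ x (-μ • e) = -α * ε / p := by
      rw [hDρ, inner_smul_right, real_inner_self_eq_norm_sq, he1, hμ]
      have := hα.ne
      field_simp
      ring
    rw [e1, ← hHw, e2] at h1
    have hloc := h1.isLocalMin (by apply div_pos _ hp; nlinarith)
    have hcU : ∀ᶠ s : ℝ in 𝓝 0, x + s • w + s ^ 2 • (-μ • e) ∈ U := by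
      have hc : ContinuousAt (fun s : ℝ => x + s • w + s ^ 2 • (-μ • e)) 0 := by fun_prop
      exact hc.eventually_mem (hρ.isOpen.mem_nhds (by simpa using hρ.mem))
    have hcΩ : ∀ᶠ s : ℝ in 𝓝 0, y + s • w ∈ Ω := by
      have hc : ContinuousAt (fun s : ℝ => y + s • w) 0 := by fun_prop
      exact hc.eventually_mem (hΩ.mem_nhds (by simpa using hy))
    have hpos : ∀ᶠ s : ℝ in 𝓝 0, 0 < r + μ * s ^ 2 := by
      have hc : ContinuousAt (fun s : ℝ => r + μ * s ^ 2) 0 := by fun_prop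
      exact hc.eventually_const_lt (by simpa using hrpos)
    have h2 : HasSecondDerivAt (fun s => ψ (r + μ * s ^ 2)) (p * 0)
        (q * 0 * 0 + p * (2 * μ)) 0 :=
      HasSecondDerivAt.comp (g := fun s => r + μ * s ^ 2) (by simpa using hψ2)
        (HasSecondDerivAt.quadratic r μ)
    have h3 := ((hvy.hasSecondDerivAt_line w).touching h2 (by
      filter_upwards [hloc, hcU, hcΩ, hpos] with s hs1 hs2 hs3 hs4
      simp only [zero_smul, add_zero, ne_eq, OfNat.ofNat_ne_zero, not_false_eq_true, zero_pow,
        hρ0] at hs1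
      have hout : x + s • w + s ^ 2 • (-μ • e) ∉ Ω := fun hin =>
        absurd ((hρ.mem_iff _ hs2).1 hin) (not_lt.2 hs1)
      have h4 := hmax' _ hout _ hs3
      have e3 : y + s • w - (x + s • w + s ^ 2 • (-μ • e)) = (r + μ * s ^ 2) • e := by
        rw [add_smul, ← hyx]
        module
      rw [e3, norm_smul, he1, mul_one, Real.norm_eq_abs, abs_of_pos hs4] at h4
      simpa using h4)).2
    refine h3.trans (le_of_eq ?_)
    rw [hμ]
    have := hα.ne
    field_simp
    ring
  have hmean := hΩm x hx U ρ hρ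
  rw [sum_principalCurvatures hρ.contDiffAt he1 hα.ne hg] at hmean
  have hgpos : 0 < ‖∇ ρ x‖ := norm_pos_iff.2 (hρ.gradient_ne_zero x hρ.mem)
  have hH : 0 ≤ ∑ i, fderiv ℝ (fderiv ℝ ρ) x (EuclideanSpace.single i 1 - e i • e)
      (EuclideanSpace.single i 1 - e i • e) := nonneg_of_mul_nonneg_right hmean (inv_pos.2 hgpos)
  calc _ ≤ ∑ i, p / α * fderiv ℝ (fderiv ℝ ρ) x (EuclideanSpace.single i 1 - e i • e)
        (EuclideanSpace.single i 1 - e i • e) :=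
        Finset.sum_le_sum fun i _ => hcurv _ (inner_single_sub_smul he1 i)
    _ = p / α * ∑ i, fderiv ℝ (fderiv ℝ ρ) x (EuclideanSpace.single i 1 - e i • e)
        (EuclideanSpace.single i 1 - e i • e) := by rw [Finset.mul_sum]
    _ ≤ 0 := mul_nonpos_of_nonpos_of_nonneg (div_nonpos_of_nonneg_of_nonpos hp.le hα.le) hH

end Touching

/-! ### The two-point maximum principle for the flow. -/

namespace IsGraphMCFDirichletSolution

variable {n : ℕ} {Ω : Set (EuclideanSpace ℝ (Fin n))} {T : ℝ}
  {u₀ : EuclideanSpace ℝ (Fin n) → ℝ} {u : EuclideanSpace ℝ (Fin n) → ℝ → ℝ}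

theorem contDiffAt (hu : IsGraphMCFDirichletSolution Ω T u₀ u) (hΩ : IsOpen Ω)
    {x : EuclideanSpace ℝ (Fin n)} {t : ℝ} (hx : x ∈ Ω) (ht : t ∈ Ioo 0 T) :
    ContDiffAt ℝ 2 (fun p : EuclideanSpace ℝ (Fin n) × ℝ => u p.1 p.2) (x, t) :=
  (hu.smooth.contDiffAt ((hΩ.prod isOpen_Ioo).mem_nhds ⟨hx, ht⟩)).of_le (m := 2) ENat.LEInfty.out

theorem contDiffAt_space (hu : IsGraphMCFDirichletSolution Ω T u₀ u) (hΩ : IsOpen Ω)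
    {x : EuclideanSpace ℝ (Fin n)} {t : ℝ} (hx : x ∈ Ω) (ht : t ∈ Ioo 0 T) :
    ContDiffAt ℝ 2 (fun y => u y t) x :=
  (hu.contDiffAt hΩ hx ht).comp x (f := fun y => (y, t)) (by fun_prop)

theorem hasDerivAt_time (hu : IsGraphMCFDirichletSolution Ω T u₀ u) (hΩ : IsOpen Ω)
    {x : EuclideanSpace ℝ (Fin n)} {t : ℝ} (hx : x ∈ Ω) (ht : t ∈ Ioo 0 T) :
    HasDerivAt (fun s => u x s) (graphMCFOperator (fun y => u y t) x) t := by
  have h1 : ContDiffAt ℝ 2 (fun s => u x s) t :=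
    (hu.contDiffAt hΩ hx ht).comp t (f := fun s => (x, s)) (by fun_prop)
  rw [← hu.equation x hx t ht]
  exact (h1.differentiableAt (by simp)).hasDerivAt

/-- The two-point maximum principle: a modulus which moves by curve shortening flow and bounds the
oscillation of `u` at small times bounds it at all times. -/
theorem sub_le_modulus (hu : IsGraphMCFDirichletSolution Ω T u₀ u) (hΩ : IsOpen Ω)
    (hΩb : Bornology.IsBounded Ω) (hΩ2 : HasC2Boundary Ω) (hΩm : IsMeanConvex Ω)
    {Φ : ℝ → ℝ → ℝ} {R : ℝ}
    (hΦc : ContinuousOn (fun p : ℝ × ℝ => Φ p.1 p.2) (Ici 0 ×ˢ Ioo 0 R))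
    (hΦ : ∀ z > 0, ∀ t ∈ Ioo 0 R, IsCSFAt Φ z t)
    (hmono : ∀ t ∈ Ioo 0 R, MonotoneOn (fun z => Φ z t) (Ici 0))
    (hzero : ∀ t ∈ Ioo 0 R, Φ 0 t = 0)
    (hinit : ∀ ε > 0, ∀ᶠ τ in 𝓝[>] (0 : ℝ), ∀ x ∈ closure Ω, ∀ y ∈ closure Ω,
      u y τ - u x τ ≤ Φ ‖y - x‖ τ + ε)
    {t : ℝ} (ht : t ∈ Ioo 0 T) (htR : t < R) {x y : EuclideanSpace ℝ (Fin n)}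
    (hx : x ∈ closure Ω) (hy : y ∈ closure Ω) : u y t - u x t ≤ Φ ‖y - x‖ t := by
  by_contra! hlt
  set η := u y t - u x t - Φ ‖y - x‖ t with hη
  have hηpos : 0 < η := by linarith
  have htpos := ht.1
  set ε := η / (2 * (t + 1)) with hε
  have hεpos : 0 < ε := by positivity
  have hεt : ε * t < η / 2 := by
    rw [hε, div_mul_eq_mul_div, div_lt_iff₀ (by positivity)]
    nlinarith
  obtain ⟨τ, hτinit, hτ⟩ := ((hinit (η / 2) (by positivity)).and (Ioo_mem_nhdsGT htpos)).exists
  have hsT : ∀ s ∈ Icc τ t, s ∈ Ioo 0 T := fun s hs =>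
    ⟨hτ.1.trans_le hs.1, hs.2.trans_lt ht.2⟩
  have hsR : ∀ s ∈ Icc τ t, s ∈ Ioo 0 R := fun s hs =>
    ⟨hτ.1.trans_le hs.1, hs.2.trans_lt htR⟩
  let D : (EuclideanSpace ℝ (Fin n) × EuclideanSpace ℝ (Fin n)) × ℝ → ℝ := fun P =>
    u P.1.2 P.2 - u P.1.1 P.2 - Φ ‖P.1.2 - P.1.1‖ P.2 - ε * P.2
  set K := (closure Ω ×ˢ closure Ω) ×ˢ Icc τ t with hK
  have hKc : IsCompact K :=
    (hΩb.isCompact_closure.prod hΩb.isCompact_closure).prod isCompact_Icc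
  have hDc : ContinuousOn D K := by
    have h1 : ContinuousOn (fun P : (EuclideanSpace ℝ (Fin n) × EuclideanSpace ℝ (Fin n)) × ℝ =>
        u P.1.2 P.2) K :=
      hu.continuousOn.comp (f := fun P : (EuclideanSpace ℝ (Fin n) × EuclideanSpace ℝ (Fin n)) × ℝ
        => (P.1.2, P.2)) (by fun_prop) fun P hP => ⟨hP.1.2, Ioo_subset_Ico_self (hsT _ hP.2)⟩
    have h2 : ContinuousOn (fun P : (EuclideanSpace ℝ (Fin n) × EuclideanSpace ℝ (Fin n)) × ℝ =>
        u P.1.1 P.2) K :=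
      hu.continuousOn.comp (f := fun P : (EuclideanSpace ℝ (Fin n) × EuclideanSpace ℝ (Fin n)) × ℝ
        => (P.1.1, P.2)) (by fun_prop) fun P hP => ⟨hP.1.1, Ioo_subset_Ico_self (hsT _ hP.2)⟩
    have h3 : ContinuousOn (fun P : (EuclideanSpace ℝ (Fin n) × EuclideanSpace ℝ (Fin n)) × ℝ =>
        Φ ‖P.1.2 - P.1.1‖ P.2) K :=
      hΦc.comp (f := fun P : (EuclideanSpace ℝ (Fin n) × EuclideanSpace ℝ (Fin n)) × ℝ
        => (‖P.1.2 - P.1.1‖, P.2)) (by fun_prop) fun P hP => ⟨norm_nonneg _, hsR _ hP.2⟩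
    exact ((h1.sub h2).sub h3).sub (by fun_prop)
  obtain ⟨⟨⟨a, b⟩, s⟩, ⟨⟨ha, hb⟩, hs⟩, hmaxD⟩ :=
    hKc.exists_isMaxOn ⟨((x, y), t), ⟨hx, hy⟩, hτ.2.le, le_rfl⟩ hDc
  simp only at ha hb hs
  have hmax : ∀ a' ∈ closure Ω, ∀ b' ∈ closure Ω, ∀ s' ∈ Icc τ t,
      u b' s' - u a' s' - Φ ‖b' - a'‖ s' - ε * s' ≤ u b s - u a s - Φ ‖b - a‖ s - ε * s :=
    fun a' ha' b' hb' s' hs' => hmaxD (show ((a', b'), s') ∈ K from ⟨⟨ha', hb'⟩, hs'⟩)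
  have hsT' := hsT s hs
  have hsR' := hsR s hs
  have hval : η / 2 < u b s - u a s - Φ ‖b - a‖ s - ε * s := by
    linarith [hmax x hx y hy t ⟨hτ.2.le, le_rfl⟩]
  have hεs : 0 < ε * s := mul_pos hεpos hsT'.1
  have hτs : τ < s := by
    rcases hs.1.eq_or_lt with h | h
    · subst h; linarith [hτinit a ha b hb]
    · exact h
  have hab : a ≠ b := by
    rintro rfl
    rw [sub_self, sub_self, norm_zero, hzero s hsR'] at hval
    linarith
  have hr : 0 < ‖b - a‖ := norm_pos_iff.2 (sub_ne_zero.2 hab.symm)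
  have hΦnonneg : 0 ≤ Φ ‖b - a‖ s := by
    rw [← hzero s hsR']
    exact hmono s hsR' (mem_Ici.2 le_rfl) hr.le hr.le
  obtain ⟨ft, p, q, h1, h2, h3⟩ := hΦ _ hr s hsR'
  have hmon := hmono s hsR'
  have hεd : HasDerivAt (fun s => ε * s) ε s := by simpa using (hasDerivAt_id s).const_mul ε
  have hin : ∀ s' ∈ Icc τ s, s' ∈ Icc τ t := fun s' hs' => ⟨hs'.1, hs'.2.trans hs.2⟩
  have hfr : frontier Ω ⊆ closure Ω := frontier_subset_closure
  rw [closure_eq_self_union_frontier] at ha hb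
  rcases ha with ha | ha <;> rcases hb with hb | hb
  · have htime := (((hu.hasDerivAt_time hΩ hb hsT').sub (hu.hasDerivAt_time hΩ ha hsT')).sub
      h1).sub hεd
    have h4 := htime.nonneg_of_forall_le_left hτs fun s' hs' =>
      hmax a (subset_closure ha) b (subset_closure hb) s' (hin s' hs')
    have h5 := graphMCFOperator_sub_le_of_interior_max hΩ ha hb hab
      (hu.contDiffAt_space hΩ ha hsT') (hu.contDiffAt_space hΩ hb hsT') hmon h2
      fun a' ha' b' hb' => by
        linarith [hmax a' (subset_closure ha') b' (subset_closure hb') s hs]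
    linarith
  · have htime := ((hu.hasDerivAt_time hΩ ha hsT').neg.sub h1).sub hεd
    have h4 := htime.nonneg_of_forall_le_left hτs fun s' hs' => by
      have := hmax a (subset_closure ha) b (hfr hb) s' (hin s' hs')
      rw [hu.boundary b hb s' (hsT s' (hin s' hs')), hu.boundary b hb s hsT'] at this
      simpa only [Pi.neg_apply, Pi.sub_apply, zero_sub] using this
    -- With b on the boundary the roles are exchanged: -u is again a solution, and a is the moving
    -- point.
    have h5 := graphMCFOperator_le_of_boundary_max hΩ hΩ2 hΩm (v := fun z => -u z s) hb ha
      (hu.contDiffAt_space hΩ ha hsT').neg hmon (by rwa [norm_sub_rev]) fun b' hb' a' ha' => by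
        have := hmax a' (subset_closure ha') b' (hfr hb') s hs
        rw [hu.boundary b hb s hsT', hu.boundary b' hb' s hsT'] at this
        rw [norm_sub_rev a' b', norm_sub_rev a b]
        linarith
    rw [graphMCFOperator_neg] at h5
    linarith
  · have htime := ((hu.hasDerivAt_time hΩ hb hsT').sub h1).sub hεd
    have h4 := htime.nonneg_of_forall_le_left hτs fun s' hs' => by
      have := hmax a (hfr ha) b (subset_closure hb) s' (hin s' hs')
      rw [hu.boundary a ha s' (hsT s' (hin s' hs')), hu.boundary a ha s hsT'] at this
      simpa only [Pi.sub_apply, sub_zero] using this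
    have h5 := graphMCFOperator_le_of_boundary_max hΩ hΩ2 hΩm (v := fun z => u z s) ha hb
      (hu.contDiffAt_space hΩ hb hsT') hmon h2 fun a' ha' b' hb' => by
        have := hmax a' (hfr ha') b' (subset_closure hb') s hs
        rw [hu.boundary a ha s hsT', hu.boundary a' ha' s hsT'] at this
        linarith
    linarith
  · rw [hu.boundary a ha s hsT', hu.boundary b hb s hsT'] at hval
    linarith

/-- The oscillation of `u` at small times, close to and away from the diagonal. -/
theorem eventually_sub_le (hu : IsGraphMCFDirichletSolution Ω T u₀ u)
    (hΩb : Bornology.IsBounded Ω) (hT : 0 < T) {M : ℝ} (hM : ∀ x ∈ Ω, |u₀ x| ≤ M)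
    {ε : ℝ} (hε : 0 < ε) :
    ∃ d > 0, ∀ τ ∈ Ioo 0 d, ∀ x ∈ closure Ω, ∀ y ∈ closure Ω,
      u y τ - u x τ ≤ 2 * M + ε ∧ (‖y - x‖ < d → u y τ - u x τ ≤ ε) := by
  have hcl : ∀ x ∈ closure Ω, |u x 0| ≤ M := by
    have hc : ContinuousOn (fun x => u x 0) (closure Ω) :=
      hu.continuousOn.comp (f := fun x => (x, (0 : ℝ))) (by fun_prop)
        fun x hx => ⟨hx, le_rfl, hT⟩
    intro x hx
    exact le_on_closure (fun z hz => by rw [hu.initial z hz]; exact hM z hz) hc.abs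
      continuousOn_const hx
  have hcomp : IsCompact (closure Ω ×ˢ Icc 0 (T / 2)) :=
    hΩb.isCompact_closure.prod isCompact_Icc
  have huc := hcomp.uniformContinuousOn_of_continuous (hu.continuousOn.mono
    (prod_mono subset_rfl fun s hs => ⟨hs.1, by linarith [hs.2]⟩))
  obtain ⟨d, hd, hdu⟩ := Metric.uniformContinuousOn_iff.1 huc (ε / 2) (by positivity)
  refine ⟨min d (T / 2), lt_min hd (by positivity), fun τ hτ x hx y hy => ⟨?_, fun hxy => ?_⟩⟩
  · have hτ1 : τ < d := hτ.2.trans_le (min_le_left _ _)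
    have hτ2 : τ ≤ T / 2 := (hτ.2.trans_le (min_le_right _ _)).le
    have key : ∀ z ∈ closure Ω, |u z τ| ≤ M + ε / 2 := by
      intro z hz
      have h1 := hdu (z, τ) ⟨hz, hτ.1.le, hτ2⟩ (z, 0) ⟨hz, le_rfl, by positivity⟩ (by
        simpa [Prod.dist_eq, Real.dist_eq, abs_of_pos hτ.1] using ⟨hd, hτ1⟩)
      rw [Real.dist_eq] at h1
      have h2 := abs_sub_abs_le_abs_sub (u z τ) (u z 0)
      have h3 := hcl z hz
      simp only at h1
      linarith
    have h1 := abs_le.1 (key x hx)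
    have h2 := abs_le.1 (key y hy)
    linarith
  · have hτ2 : τ ≤ T / 2 := (hτ.2.trans_le (min_le_right _ _)).le
    have h1 := hdu (y, τ) ⟨hy, hτ.1.le, hτ2⟩ (x, τ) ⟨hx, hτ.1.le, hτ2⟩ (by
      simpa [Prod.dist_eq, dist_eq_norm] using hxy.trans_le (min_le_left _ _))
    rw [Real.dist_eq] at h1
    have := (abs_lt.1 h1).2
    simp only at this
    linarith

/-- The zero function is itself an admissible modulus. -/
theorem sub_eq_zero_of_initial_eq_zero (hu : IsGraphMCFDirichletSolution Ω T u₀ u)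
    (hΩ : IsOpen Ω) (hΩb : Bornology.IsBounded Ω) (hΩ2 : HasC2Boundary Ω) (hΩm : IsMeanConvex Ω)
    (h0 : ∀ x ∈ Ω, |u₀ x| ≤ 0) {t : ℝ} (ht : t ∈ Ioo 0 T) {x y : EuclideanSpace ℝ (Fin n)}
    (hx : x ∈ closure Ω) (hy : y ∈ closure Ω) : u y t - u x t = 0 := by
  have key : ∀ x ∈ closure Ω, ∀ y ∈ closure Ω, u y t - u x t ≤ 0 := fun x hx y hy =>
    hu.sub_le_modulus hΩ hΩb hΩ2 hΩm (Φ := fun _ _ => 0) (R := t + 1) continuousOn_const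
      (fun z _ s _ => ⟨0, 0, 0, hasDerivAt_const s 0, HasSecondDerivAt.const 0 z, by simp⟩)
      (fun s _ => monotoneOn_const) (fun _ _ => rfl) (fun ε hε => by
        obtain ⟨d, hd, hdu⟩ := hu.eventually_sub_le hΩb (ht.1.trans ht.2) h0 hε
        filter_upwards [Ioo_mem_nhdsGT hd] with τ hτ x hx y hy
        simpa using (hdu τ hτ x hx y hy).1) ht (by linarith) hx hy
  linarith [key x hx y hy, key y hy x hx]

theorem sub_le_step (hu : IsGraphMCFDirichletSolution Ω T u₀ u) (hΩ : IsOpen Ω)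
    (hΩb : Bornology.IsBounded Ω) (hΩ2 : HasC2Boundary Ω) (hΩm : IsMeanConvex Ω)
    {M : ℝ} (hMpos : 0 < M) (hM : ∀ x ∈ Ω, |u₀ x| ≤ M) {S : ℝ} {φ : ℝ → ℝ → ℝ}
    (hφ : IsStepCSFSolution S φ) {t : ℝ} (ht : t ∈ Ioo 0 T) (htS : t / (2 * M) ^ 2 < S)
    {x y : EuclideanSpace ℝ (Fin n)} (hx : x ∈ closure Ω) (hy : y ∈ closure Ω) :
    u y t - u x t ≤ 2 * M * φ (‖y - x‖ / (2 * M)) (t / (2 * M) ^ 2) := by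
  have hc : 0 < 2 * M := by positivity
  have hscale : ∀ s ∈ Ioo 0 ((2 * M) ^ 2 * S), s / (2 * M) ^ 2 ∈ Ioo 0 S := fun s hs =>
    ⟨div_pos hs.1 (by positivity), by rw [div_lt_iff₀' (by positivity)]; exact hs.2⟩
  refine hu.sub_le_modulus hΩ hΩb hΩ2 hΩm
    (Φ := fun z s => 2 * M * φ (z / (2 * M)) (s / (2 * M) ^ 2)) (R := (2 * M) ^ 2 * S)
    ?_ ?_ ?_ ?_ ?_ ht (by rwa [div_lt_iff₀' (by positivity)] at htS) hx hy
  · refine ContinuousOn.mul continuousOn_const ?_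
    exact hφ.smooth.continuousOn.comp
      (f := fun p : ℝ × ℝ => (p.1 / (2 * M), p.2 / (2 * M) ^ 2)) (by fun_prop)
      fun p hp => ⟨div_nonneg hp.1 hc.le, hscale _ hp.2⟩
  · exact fun z hz s hs => (hφ.isCSFAt (div_pos hz hc) (hscale s hs)).rescale hc.ne'
  · intro s hs z hz w hw hzw
    have := hφ.monotoneOn (hscale s hs) (div_nonneg hz hc.le) (div_nonneg hw hc.le)
      (div_le_div_of_nonneg_right hzw hc.le)
    exact mul_le_mul_of_nonneg_left this hc.le
  · intro s hs
    simp [hφ.boundary _ (hscale s hs)]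
  · intro ε hε
    obtain ⟨d, hd, hdu⟩ := hu.eventually_sub_le hΩb (ht.1.trans ht.2) hM (half_pos hε)
    have hpi := Real.pi_pos
    have hS : 0 < (2 * M) ^ 2 * S := by
      have : 0 < S := (div_pos ht.1 (by positivity)).trans htS
      positivity
    filter_upwards [Ioo_mem_nhdsGT (lt_min (lt_min hd hS)
      (show 0 < d * ε / Real.pi by positivity))] with τ hτ a ha b hb
    have hτd : τ < d := hτ.2.trans_le ((min_le_left _ _).trans (min_le_left _ _))
    have hτS := hscale τ ⟨hτ.1, hτ.2.trans_le ((min_le_left _ _).trans (min_le_right _ _))⟩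
    have hτε : τ < d * ε / Real.pi := hτ.2.trans_le (min_le_right _ _)
    obtain ⟨h1, h2⟩ := hdu τ ⟨hτ.1, hτd⟩ a ha b hb
    -- Near the diagonal u oscillates by at most ε/2 and φ ≥ 0 suffices; away from it `one_sub_le`
    -- brings the modulus within ε/2 of 2M. The behaviour of φ at the corner is never needed.
    rcases lt_or_ge ‖b - a‖ d with hlt | hge
    · have h3 := hφ.nonneg (z := ‖b - a‖ / (2 * M)) (by positivity) hτS
      have h4 := mul_nonneg hc.le h3
      linarith [h2 hlt]
    · have hr : 0 < ‖b - a‖ := hd.trans_le hge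
      have h3 := hφ.one_sub_le (z := ‖b - a‖ / (2 * M)) (by positivity) hτS
      have h4 := mul_le_mul_of_nonneg_left h3 hc.le
      have h5 : 2 * M * (1 - Real.pi * (τ / (2 * M) ^ 2) / (2 * (‖b - a‖ / (2 * M))))
          = 2 * M - Real.pi * τ / (2 * ‖b - a‖) := by
        field_simp
      have h6 : Real.pi * τ / (2 * ‖b - a‖) ≤ ε / 2 := by
        rw [div_le_iff₀ (by positivity)]
        rw [lt_div_iff₀ hpi] at hτε
        nlinarith
      linarith

end IsGraphMCFDirichletSolution

/-! ### From the modulus to the gradient bound. -/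

theorem HasDerivWithinAt.nonneg_of_eventually_le_right {f : ℝ → ℝ} {f' a : ℝ}
    (hf : HasDerivWithinAt f f' (Ici a) a) (hle : ∀ᶠ s in 𝓝[>] a, f a ≤ f s) : 0 ≤ f' := by
  have h1 := hf.mono Ioi_subset_Ici_self
  rw [hasDerivWithinAt_iff_tendsto_slope' (by simp)] at h1
  refine ge_of_tendsto h1 ?_
  filter_upwards [hle, self_mem_nhdsWithin] with s hs hs'
  rw [slope_def_field]
  exact div_nonneg (sub_nonneg.2 hs) (sub_nonneg.2 (le_of_lt hs'))

/-- A modulus of continuity bounds the gradient by its slope at zero. -/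
theorem norm_gradient_le_of_modulus {n : ℕ} {v : EuclideanSpace ℝ (Fin n) → ℝ}
    {x : EuclideanSpace ℝ (Fin n)} {ψ : ℝ → ℝ} {L : ℝ} (hv : DifferentiableAt ℝ v x)
    (hψ : HasDerivWithinAt ψ L (Ici 0) 0) (hψ0 : ψ 0 = 0) (hL : 0 ≤ L)
    (hle : ∀ᶠ y in 𝓝 x, v y - v x ≤ ψ ‖y - x‖) : ‖∇ v x‖ ≤ L := by
  set g := ∇ v x with hg
  have hline : HasDerivAt (fun s : ℝ => v (x + s • g)) (fderiv ℝ v x g) 0 := by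
    have h1 : HasDerivAt (fun s : ℝ => x + s • g) g 0 := by
      simpa using ((hasDerivAt_id (0 : ℝ)).smul_const g).const_add x
    have h2 : HasFDerivAt v (fderiv ℝ v x) (x + (0 : ℝ) • g) := by simpa using hv.hasFDerivAt
    exact h2.comp_hasDerivAt (0 : ℝ) h1
  have hψg : HasDerivWithinAt (fun s : ℝ => ψ (s * ‖g‖)) (L * ‖g‖) (Ici 0) 0 := by
    have h1 : HasDerivWithinAt (fun s : ℝ => s * ‖g‖) ‖g‖ (Ici 0) 0 := by
      simpa using ((hasDerivAt_id (0 : ℝ)).mul_const ‖g‖).hasDerivWithinAt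
    have h2 : HasDerivWithinAt ψ L (Ici 0) ((0 : ℝ) * ‖g‖) := by simpa using hψ
    exact h2.comp (0 : ℝ) h1 fun s hs => mul_nonneg hs (norm_nonneg g)
  have hdiff := (hψg.sub hline.hasDerivWithinAt).nonneg_of_eventually_le_right (by
    have hc : ContinuousAt (fun s : ℝ => x + s • g) 0 := by fun_prop
    have hev : ∀ᶠ s : ℝ in 𝓝 0, v (x + s • g) - v x ≤ ψ ‖x + s • g - x‖ := by
      refine hc.eventually (p := fun y => v y - v x ≤ ψ ‖y - x‖) ?_
      simpa only [zero_smul, add_zero] using hle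
    filter_upwards [mem_nhdsWithin_of_mem_nhds hev, self_mem_nhdsWithin] with s hs hs'
    rw [add_sub_cancel_left, norm_smul, Real.norm_eq_abs, abs_of_pos hs'] at hs
    simp only [Pi.sub_apply, zero_mul, zero_smul, add_zero, hψ0]
    linarith)
  rw [← inner_gradient_eq_fderiv, ← hg, real_inner_self_eq_norm_sq] at hdiff
  by_contra! hcon
  nlinarith [hL.trans_lt hcon]

/-- The value at 0 is not prescribed: if it differs from c, the function is discontinuous there and
`derivWithin` takes its default value 0. -/
theorem derivWithin_step_eq_zero {φ : ℝ → ℝ} {c : ℝ} (h : ∀ z > 0, φ z = c) :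
    derivWithin φ (Ici 0) 0 = 0 := by
  by_cases hd : DifferentiableWithinAt ℝ φ (Ici 0) 0
  · have h0 : φ 0 = c := by
      have h1 : Tendsto φ (𝓝[>] 0) (𝓝 (φ 0)) :=
        hd.continuousWithinAt.mono_left (nhdsWithin_mono _ Ioi_subset_Ici_self)
      refine tendsto_nhds_unique h1 (tendsto_const_nhds.congr' ?_)
      filter_upwards [self_mem_nhdsWithin] with z hz using (h z hz).symm
    have h1 : EqOn φ (fun _ => c) (Ici 0) := fun z hz => by
      rcases (show (0 : ℝ) ≤ z from hz).eq_or_lt with rfl | hz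
      · exact h0
      · exact h z hz
    rw [derivWithin_congr h1 h0]
    simp
  · exact derivWithin_zero_of_not_differentiableWithinAt hd

theorem mainTheorem3 {n : ℕ} (Ω : Set (EuclideanSpace ℝ (Fin n)))
    (hΩo : IsOpen Ω) (hΩc : IsConnected Ω) (hΩb : Bornology.IsBounded Ω)
    (hΩ2 : HasC2Boundary Ω) (hΩm : IsMeanConvex Ω)
    (T : ℝ) (u₀ : EuclideanSpace ℝ (Fin n) → ℝ) (u : EuclideanSpace ℝ (Fin n) → ℝ → ℝ)
    (hu : IsGraphMCFDirichletSolution Ω T u₀ u)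
    (M : ℝ) (hM : IsLUB ((fun x => |u₀ x|) '' Ω) M)
    (S : ℝ) (φ : ℝ → ℝ → ℝ) (hφ : IsStepCSFSolution S φ) :
    ∀ t ∈ Ioo 0 T, t / (4 * M ^ 2) < S →
      (∀ x ∈ closure Ω, ∀ y ∈ closure Ω,
        |u y t - u x t| ≤ 2 * M * φ (‖y - x‖ / (2 * M)) (t / (4 * M ^ 2))) ∧
      (∀ x ∈ Ω, ‖∇ (fun y => u y t) x‖
        ≤ derivWithin (fun z => φ z (t / (4 * M ^ 2))) (Ici 0) 0) := by
  intro t ht htS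
  have hM' : ∀ x ∈ Ω, |u₀ x| ≤ M := fun x hx => hM.1 ⟨x, hx, rfl⟩
  have hM0 : 0 ≤ M := by
    obtain ⟨x, hx⟩ := hΩc.nonempty
    exact (abs_nonneg _).trans (hM' x hx)
  have hdiff : ∀ x ∈ Ω, DifferentiableAt ℝ (fun y => u y t) x := fun x hx =>
    (hu.contDiffAt_space hΩo hx ht).differentiableAt (by simp)
  rcases hM0.eq_or_lt with rfl | hMpos
  · have hconst : ∀ x ∈ closure Ω, ∀ y ∈ closure Ω, u y t - u x t = 0 := fun x hx y hy =>
      hu.sub_eq_zero_of_initial_eq_zero hΩo hΩb hΩ2 hΩm hM' ht hx hy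
    refine ⟨fun x hx y hy => by simp [hconst x hx y hy], fun x hx => ?_⟩
    -- Division by zero sends the time to 0, so the right-hand side is the one-sided slope of the
    -- initial step.
    have h0 : t / (4 * (0 : ℝ) ^ 2) = 0 := by simp
    rw [h0, derivWithin_step_eq_zero (φ := fun z => φ z 0) hφ.initial]
    refine norm_gradient_le_of_modulus (ψ := fun _ => 0) (hdiff x hx)
      (hasDerivWithinAt_const _ _ _) rfl le_rfl ?_
    filter_upwards [hΩo.mem_nhds hx] with y hy
    exact (hconst x (subset_closure hx) y (subset_closure hy)).le
  · have hc : 0 < 2 * M := by positivity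
    rw [show 4 * M ^ 2 = (2 * M) ^ 2 by ring] at htS ⊢
    have hbound : ∀ x ∈ closure Ω, ∀ y ∈ closure Ω,
        u y t - u x t ≤ 2 * M * φ (‖y - x‖ / (2 * M)) (t / (2 * M) ^ 2) := fun x hx y hy =>
      hu.sub_le_step hΩo hΩb hΩ2 hΩm hMpos hM' hφ ht htS hx hy
    refine ⟨fun x hx y hy => abs_le'.2 ⟨hbound x hx y hy, ?_⟩, fun x hx => ?_⟩
    · have := hbound y hy x hx
      rw [norm_sub_rev x y] at this
      linarith
    · set s := t / (2 * M) ^ 2 with hs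
      have hsS : s ∈ Ioo 0 S := ⟨div_pos ht.1 (by positivity), htS⟩
      have hsec : DifferentiableWithinAt ℝ (fun z => φ z s) (Ici 0) 0 := by
        have h1 : ContDiffOn ℝ ∞ (fun z => φ z s) (Ici 0) :=
          hφ.smooth.comp (f := fun z => (z, s)) (by fun_prop) fun z hz => ⟨hz, hsS⟩
        exact h1.differentiableOn (by simp) 0 (mem_Ici.2 le_rfl)
      have hL := hsec.hasDerivWithinAt
      set L := derivWithin (fun z => φ z s) (Ici 0) 0 with hLdef
      have hL0 : 0 ≤ L := hL.nonneg_of_eventually_le_right (by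
        filter_upwards [self_mem_nhdsWithin] with z hz
        rw [hφ.boundary s hsS]
        exact hφ.nonneg (le_of_lt hz) hsS)
      refine norm_gradient_le_of_modulus (ψ := fun z => 2 * M * φ (z / (2 * M)) s) (hdiff x hx)
        ?_ (by simp [hφ.boundary s hsS]) hL0 ?_
      · have h1 : HasDerivWithinAt (fun z : ℝ => z / (2 * M)) (1 / (2 * M)) (Ici 0) 0 :=
          ((hasDerivAt_id (0 : ℝ)).div_const _).hasDerivWithinAt
        have h2 : HasDerivWithinAt (fun z => φ z s) L (Ici 0) ((0 : ℝ) / (2 * M)) := by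
          simpa using hL
        have h3 := (h2.comp (0 : ℝ) h1 fun z hz => div_nonneg hz hc.le).const_mul (2 * M)
        exact h3.congr_deriv (by field_simp)
      · filter_upwards [hΩo.mem_nhds hx] with y hy
        exact hbound x (subset_closure hx) y (subset_closure hy)
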